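/- Let $X$ be a finite group with identity $e$, $G\subset X$ a subgroup and $M\subset X$ a set with $e\in M$ such that every $x\in X$ is uniquely $x=us$ with $u\in G$, $s\in M$. For $s,t\in M$, $u\in G$ define $\tau(s,t),\,s\triangleright u\in G$ and $s\cdot t,\,s\triangleleft u\in M$ by $st=\tau(s,t)(s\cdot t)$ and $su=(s\triangleright u)(s\triangleleft u)$. Assume that $(M,\cdot)$ has left division: for all $s,t\in M$ there is a unique $p\in M$ with $s\cdot p=t$. Let $s^L\in M$ be defined by $s^L\cdot s=e$, and let $k$ be a field. **The category $\mathcal D$.** An object is a finite-dimensional $k$-vector space $V$ with compatible $M$- and $G$-gradings (written $\langle\xi\rangle\in M$, $|\xi|\in G$ for homogeneous $\xi$), a right action $\bar\triangleleft$ of the group $G$, and linear maps $s\,\bar\triangleright:V\to V$ ($s\in M$) with $e\,\bar\triangleright\,\xi=\xi$, such that for homogeneous $\xi$ (grades of zero vectors being disregarded) $$\langle\xi\bar\triangleleft u\rangle=\langle\xi\rangle\triangleleft u,\quad |\xi\bar\triangleleft u|=(\langle\xi\rangle\triangleright u)^{-1}|\xi|u,\quad s\cdot\langle\xi\rangle=\langle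 s\bar\triangleright\xi\rangle\cdot(s\triangleleft|\xi|),$$ $$\tau(s,\langle\xi\rangle)^{-1}(s\triangleright|\xi|)=\tau(\langle s\bar\triangleright\xi\rangle,s\triangleleft|\xi|)^{-1}|s\bar\triangleright\xi|,\quad (s\bar\triangleright\xi)\bar\triangleleft((s\triangleleft|\xi|)\triangleright u)=(s\triangleleft(\langle\xi\rangle\triangleright u))\bar\triangleright(\xi\bar\triangleleft u),$$ $$p\bar\triangleright(t\bar\triangleright\xi)=((p'\cdot t)\bar\triangleright\xi)\bar\triangleleft\tau(p'\triangleleft(t\triangleright|\xi|),t\triangleleft|\xi|)^{-1},\quad p'=p\triangleleft\tau(\langle t\bar\triangleright\xi\rangle,t\triangleleft|\xi|)\tau(t,\langle\xi\rangle)^{-1}.$$ Morphisms are the linear maps preserving both gradings and both actions. The tensor product is the tensor product of vector spaces with $$\langle\xi\otimes\eta\rangle=\langle\xi\rangle\cdot\langle\eta\rangle,\quad |\xi\otimes\eta|=\tau(\langle\xi\rangle,\langle\eta\rangle)^{-1}|\xi||\eta|,\quad (\xi\otimes\eta)\bar\triangleleft u=\xi\bar\triangleleft(\langle\eta\rangle\triangleright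 u)\otimes\eta\bar\triangleleft u,$$ $$(s\triangleleft\tau(\langle\xi\rangle,\langle\eta\rangle))\bar\triangleright(\xi\otimes\eta)=(s\bar\triangleright\xi)\bar\triangleleft\tau(s\triangleleft|\xi|,\langle\eta\rangle)\tau(\langle(s\triangleleft|\xi|)\bar\triangleright\eta\rangle,s\triangleleft|\xi||\eta|)^{-1}\otimes(s\triangleleft|\xi|)\bar\triangleright\eta .$$ The unit object is $k$ with trivial gradings and actions and the usual unit isomorphisms, the associator is $\Phi((\xi\otimes\eta)\otimes\zeta)=\xi\bar\triangleleft\tau(\langle\eta\rangle,\langle\zeta\rangle)\otimes(\eta\otimes\zeta)$, and the braiding is $\Psi(\xi\otimes\eta)=\langle\xi\rangle\bar\triangleright\eta\otimes\xi\bar\triangleleft|\eta|$. With these structures $\mathcal D$ is a braided monoidal category. Put $\|\xi\|=|\xi|^{-1}\langle\xi\rangle\in X$. Each object carries a right action $\hat\triangleleft$ of $X$ given by $\xi\hat\triangleleft us=(\xi\bar\triangleleft u)\hat\triangleleft s$ for $u\in G$, $s\in M$, where $\xi\hat\triangleleft s=((s^L\triangleleft|\xi|^{-1})\bar\triangleright\xi)\bar\triangleleft\tau(s^L,s)$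 for homogeneous $\xi$. **The double.** Let $Y=X$ as a set. Put $(us)\circ(vt)=vust$ for $u,v\in G$, $s,t\in M$; $y\tilde\triangleleft x=x^{-1}yx$; $\tilde\tau(vt,wp)=\tau(t,p)$; and $vt\,\tilde\triangleright\,x=tx{t'}^{-1}$ where $vt\,\tilde\triangleleft\,x=v't'$ with $v'\in G$, $t'\in M$. For $a=us\in Y$ with $u\in G$, $s\in M$ write $|a|=u^{-1}$ and $\langle a\rangle=s$. **The object $D$.** $D\in\mathcal D$ has basis $\delta_y\otimes x$ ($y\in Y$, $x\in X$). The element $a=\|\delta_y\otimes x\|$ is the unique solution of $y\circ a=y\tilde\triangleleft x$, and $(\delta_y\otimes x)\hat\triangleleft z=\delta_{y\tilde\triangleleft(a\tilde\triangleright z)}\otimes(a\tilde\triangleright z)^{-1}xz$. **Statement.** $D$ is a bialgebra in the braided monoidal category $\mathcal D$: it has a product, unit, coproduct and counit which are morphisms of $\mathcal D$ such that the product is associative and unital, the coproduct is coassociative and counital (all with respect to $\Phi$), $\Delta$ is multiplicative with respect to $\Psi$ and $\Phi$, and the remaining unit and counit axioms of a bialgebra hold. These structure maps are: * $(\delta_y\otimes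 x)(\delta_w\otimes z)=\delta_{w,\,y\tilde\triangleleft x}\;\delta_{y\tilde\triangleleft\tilde\tau(a,b)}\otimes\tilde\tau(a,b)^{-1}xz$ with $a=\|\delta_y\otimes x\|$, $b=\|\delta_w\otimes z\|$, and unit $I=\sum_{y}\delta_y\otimes e$; * for $h=\delta_y\otimes x$, $$\Delta(h)=\sum_{z,w\in X:\,zw=y}\big(\delta_{w\tilde\triangleleft|h||h_{(2)}|^{-1}|h_{(1)}|^{-1}}\otimes|h_{(1)}||h_{(2)}||h|^{-1}x\langle h_{(2)}\rangle^{-1}\big)\otimes\big(\delta_{z\tilde\triangleleft|h||h_{(2)}|^{-1}}\otimes|h_{(2)}||h|^{-1}x\big),$$ where, for each $(z,w)$, $\|h_{(2)}\|=|h|^{-1}z^{-1}|h|x^{-1}zx$ and $\|h_{(1)}\|=|h_{(2)}|\,\|h\|\,\langle h_{(2)}\rangle^{-1}$; * $\epsilon(\delta_y\otimes x)=\delta_{y,e}$. Moreover, for every object $V$ the formula $\xi\hat\triangleleft(\delta_y\otimes x)=\delta_{y,\|\xi\|}\,\xi\hat\triangleleft x$ defines a morphism $V\otimes D\to V$ of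 $\mathcal D$. These morphisms form unital actions of the algebra $D$ (associativity being taken with $\Phi$), the action on the unit object $k$ is $\epsilon$, and for all objects $V,W$ the action of $D$ on $V\otimes W$ is the composite $$(V\otimes W)\otimes D\xrightarrow{\mathrm{id}\otimes\Delta}(V\otimes W)\otimes(D\otimes D)\to(V\otimes D)\otimes(W\otimes D)\to V\otimes W,$$ whose middle map is built from $\Phi^{\pm1}$ and $\Psi_{W,D}$ and whose last map is the tensor product of the two actions. The product is the only morphism $D\otimes D\to D$ compatible in this sense with all the actions, and $\Delta$ is the only morphism $D\to D\otimes D$ compatible in this sense with the actions on all tensor products. -/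

import Mathlib

universe u

set_option linter.unusedSectionVars false

open CategoryTheory MonoidalCategory TensorProduct

noncomputable section

/-- A subgroup `G` of `X` together with a set `M` of left coset representatives containing the
identity: every `x : X` is uniquely of the form `x = u * s` with `u ∈ G` and `s ∈ M`. -/
structure CosetReps (X : Type u) [Group X] where
  G : Subgroup X
  M : Set X
  isComplement : Subgroup.IsComplement (G : Set X) M
  one_mem : (1 : X) ∈ M

namespace CosetReps

variable {X : Type u} [Group X] (c : CosetReps X)

instance [Finite X] : Fintype c.M := Fintype.ofFinite _

instance [Finite X] : Fintype c.G := Fintype.ofFinite _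

instance : DecidableEq c.M := Classical.decEq _

instance : DecidableEq c.G := Classical.decEq _

instance : One c.M := ⟨⟨1, c.one_mem⟩⟩

/-- The factor `u ∈ G` of `x = u * s`. -/
def gPart (x : X) : c.G := (c.isComplement.equiv x).1

/-- The factor `s ∈ M` of `x = u * s`. -/
def mPart (x : X) : c.M := (c.isComplement.equiv x).2

/-- `s · t`, from `s t = τ(s,t) (s · t)`. -/
def dot (s t : c.M) : c.M := c.mPart (s * t)

/-- `τ(s,t)`, from `s t = τ(s,t) (s · t)`. -/
def tau (s t : c.M) : c.G := c.gPart (s * t)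

/-- `s ▷ u`, from `s u = (s ▷ u) (s ◁ u)`. -/
def la (s : c.M) (u : c.G) : c.G := c.gPart (s * u)

/-- `s ◁ u`, from `s u = (s ▷ u) (s ◁ u)`. -/
def ra (s : c.M) (u : c.G) : c.M := c.mPart (s * u)

/-- The left inverse `s^L`, the unique solution of `s^L · s = e`. -/
def leftInv (s : c.M) : c.M := c.mPart (s : X)⁻¹

/-- The unique solution `p` of `p · s = t`. -/
def rightDiv (t s : c.M) : c.M := c.mPart (t * (s : X)⁻¹)

/-- `(M, ·)` has the left division property. -/
def LeftDivision : Prop := ∀ s t : c.M, ∃! p : c.M, c.dot s p = t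

theorem gPart_mul_mPart (x : X) : (c.gPart x : X) * c.mPart x = x :=
  c.isComplement.equiv_fst_mul_equiv_snd x

theorem parts_unique {x : X} {u : c.G} {s : c.M} (h : (u : X) * s = x) :
    c.gPart x = u ∧ c.mPart x = s := by
  subst h
  have : c.isComplement.equiv ((u : X) * s) = (u, s) :=
    c.isComplement.equiv.symm.injective (by rw [Equiv.symm_apply_apply]; rfl)
  exact ⟨congrArg Prod.fst this, congrArg Prod.snd this⟩

theorem mPart_mul (u : c.G) (x : X) : c.mPart (u * x) = c.mPart x :=
  (c.parts_unique (u := u * c.gPart x) (s := c.mPart x)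
    (by rw [Subgroup.coe_mul, mul_assoc, gPart_mul_mPart])).2

theorem gPart_mul (u : c.G) (x : X) : c.gPart (u * x) = u * c.gPart x :=
  (c.parts_unique (u := u * c.gPart x) (s := c.mPart x)
    (by rw [Subgroup.coe_mul, mul_assoc, gPart_mul_mPart])).1

theorem mPart_coe (s : c.M) : c.mPart s = s := (c.parts_unique (u := 1) (by simp)).2

theorem gPart_coe (s : c.M) : c.gPart s = 1 := (c.parts_unique (u := 1) (s := s) (by simp)).1

@[simp] theorem coe_one : ((1 : c.M) : X) = 1 := rfl

theorem mPart_coeG (u : c.G) : c.mPart u = 1 := (c.parts_unique (u := u) (by simp)).2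

theorem gPart_coeG (u : c.G) : c.gPart u = u := (c.parts_unique (u := u) (s := 1) (by simp)).1

/-- The `G`-part of `x`, expressed through its `M`-part. -/
theorem coe_gPart (x : X) : (c.gPart x : X) = x * (c.mPart x : X)⁻¹ := by
  rw [eq_mul_inv_iff_mul_eq, gPart_mul_mPart]

theorem mPart_inv_mul (u : c.G) (x : X) : c.mPart ((u : X)⁻¹ * x) = c.mPart x := by
  simpa using c.mPart_mul u⁻¹ x

theorem mPart_mul_mul (x y : X) : c.mPart (c.mPart x * y) = c.mPart (x * y) := by
  conv_rhs => rw [← c.gPart_mul_mPart x, mul_assoc, mPart_mul]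

theorem dot_leftInv (s : c.M) : c.dot (c.leftInv s) s = 1 := by
  rw [dot, leftInv, mPart_mul_mul, inv_mul_cancel]; exact c.mPart_coe 1

theorem dot_rightDiv (t s : c.M) : c.dot (c.rightDiv t s) s = t := by
  rw [dot, rightDiv, mPart_mul_mul]; simp [mPart_coe]

theorem eq_rightDiv {p t s : c.M} (h : c.dot p s = t) : p = c.rightDiv t s := by
  subst h
  rw [rightDiv, dot, mPart_mul_mul]; simp [mPart_coe]

/-- The `M`-grade of `s ▷̄ ξ` for `ξ` of `M`-grade `a` and `G`-grade `w`: the solution `a'` of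
`s · a = a' · (s ◁ w)`. -/
def lgrade (s a : c.M) (w : c.G) : c.M := c.rightDiv (c.dot s a) (c.ra s w)

/-- The bidegrees `(⟨ξ⟩, |ξ|)` of homogeneous elements. -/
abbrev Bideg := c.M × c.G

/-- `‖ξ‖ = |ξ|⁻¹ ⟨ξ⟩` -/
def dnorm (i : c.Bideg) : X := (i.2 : X)⁻¹ * i.1

/-- The bidegree with given `‖ξ‖`. -/
def bideg (y : X) : c.Bideg := (c.mPart y, (c.gPart y)⁻¹)

theorem dnorm_bideg (y : X) : c.dnorm (c.bideg y) = y := by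
  simp [dnorm, bideg, gPart_mul_mPart]

theorem bideg_dnorm (i : c.Bideg) : c.bideg (c.dnorm i) = i := by
  have := c.parts_unique (x := c.dnorm i) (u := i.2⁻¹) (s := i.1) (by simp [dnorm])
  simp [bideg, this]

/-- The bidegree of a tensor product of homogeneous elements:
`⟨ξ ⊗ η⟩ = ⟨ξ⟩ · ⟨η⟩` and `|ξ ⊗ η| = τ(⟨ξ⟩,⟨η⟩)⁻¹ |ξ| |η|`. -/
def tdeg (i j : c.Bideg) : c.Bideg := (c.dot i.1 j.1, (c.tau i.1 j.1)⁻¹ * i.2 * j.2)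

/-! ### The double -/

/-- `(us) ∘ (vt) = v u s t` -/
def circ (y z : X) : X := c.gPart z * y * c.mPart z

/-- `y ◁̃ x = x⁻¹ y x` -/
def raD (y x : X) : X := x⁻¹ * y * x

/-- `vt ▷̃ x = t x t'⁻¹` where `vt ◁̃ x = v' t'`. -/
def laD (y x : X) : X := c.mPart y * x * (c.mPart (raD y x) : X)⁻¹

/-- `τ̃(vt, wp) = τ(t, p)` -/
def tauD (y z : X) : c.G := c.tau (c.mPart y) (c.mPart z)

theorem bideg_circ (y z : X) : c.bideg (c.circ y z) = c.tdeg (c.bideg y) (c.bideg z) := by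
  have h := c.parts_unique (x := c.circ y z) (u := c.gPart z * c.gPart y * c.tauD y z)
    (s := c.dot (c.mPart y) (c.mPart z)) (by
      simp only [circ, tauD, tau, dot, Subgroup.coe_mul, mul_assoc, gPart_mul_mPart]
      rw [← mul_assoc (c.gPart y : X), gPart_mul_mPart])
  simp [bideg, tdeg, h, tauD, mul_assoc]

theorem mPart_dnorm (i : c.Bideg) : c.mPart (c.dnorm i) = i.1 :=
  congrArg Prod.fst (c.bideg_dnorm i)

theorem gPart_dnorm (i : c.Bideg) : c.gPart (c.dnorm i) = i.2⁻¹ := by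
  rw [← congrArg Prod.snd (c.bideg_dnorm i)]; simp [bideg]

theorem laD_mul (z x y : X) : c.laD z (x * y) = c.laD z x * c.laD (raD z x) y := by
  have : raD (raD z x) y = raD z (x * y) := by simp only [raD]; group
  simp only [laD, this]; group

theorem raD_circ (y z x : X) : raD (c.circ y z) x = c.circ (raD y (c.laD z x)) (raD z x) := by
  simp only [circ, coe_gPart, laD]
  simp only [raD]; group

theorem circ_dnorm (i j : c.Bideg) : c.circ (c.dnorm i) (c.dnorm j) = c.dnorm (c.tdeg i j) := by
  rw [← c.dnorm_bideg (c.circ _ _), bideg_circ, bideg_dnorm, bideg_dnorm]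

theorem mPart_one : c.mPart 1 = 1 := c.mPart_coe 1

theorem gPart_one : c.gPart 1 = 1 := c.gPart_coe 1

theorem circ_one (y : X) : c.circ y 1 = y := by simp [circ, mPart_one, gPart_one]

theorem one_circ (y : X) : c.circ 1 y = y := by simp [circ, gPart_mul_mPart]

theorem mPart_raD (y : X) (w : c.G) : c.mPart (raD y w) = c.ra (c.mPart y) w := by
  rw [ra, mPart_mul_mul, raD, mul_assoc, mPart_inv_mul]

theorem coe_tauD (y z : X) :
    (c.tauD y z : X) = c.mPart y * c.mPart z * (c.mPart (c.mPart y * c.mPart z) : X)⁻¹ := by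
  rw [tauD, tau, coe_gPart]

theorem parts_circ (y z : X) : c.gPart (c.circ y z) = c.gPart z * c.gPart y * c.tauD y z ∧
    c.mPart (c.circ y z) = c.mPart (c.mPart y * c.mPart z) := by
  have := c.bideg_circ y z
  constructor
  · have := congrArg Prod.snd this
    simp only [bideg, tdeg] at this
    rw [inv_eq_iff_eq_inv] at this
    rw [this]; simp [tauD, mul_assoc]
  · exact congrArg Prod.fst this

theorem circ_circ (x y z : X) : c.circ (c.circ x y) z =
    c.circ (raD x (c.tauD y z)) (c.circ y z) := by
  have h := c.parts_circ y z
  rw [circ, circ, circ, h.1, h.2]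
  simp only [raD, Subgroup.coe_mul, coe_tauD]; group

theorem laD_circ (y z x : X) : c.laD y (c.laD z x) * c.tauD (raD y (c.laD z x)) (raD z x) =
    c.tauD y z * c.laD (c.circ y z) x := by
  simp only [coe_tauD]
  rw [laD, laD, laD, raD_circ, (c.parts_circ y z).2, (c.parts_circ _ (raD z x)).2, laD]
  group

theorem tauD_one_left (y : X) : c.tauD 1 y = 1 := by
  apply Subtype.ext; rw [coe_tauD]; simp [mPart_one, mPart_coe]

end CosetReps

/-! ### Graded vector spaces -/

namespace CosetReps

section Graded

variable {k ι V W Z : Type*} [Field k] [Fintype ι] [DecidableEq ι]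
  [AddCommGroup V] [Module k V] [AddCommGroup W] [Module k W] [AddCommGroup Z] [Module k Z]

/-- The linear map on `V ⊗ W` that is `F i j` on `V_i ⊗ W_j`, where the gradings are given by the
projections `P`, `Q` to the homogeneous components. -/
def gradedLift (P : ι → Module.End k V) (Q : ι → Module.End k W)
    (F : ι → ι → (V ⊗[k] W →ₗ[k] Z)) : V ⊗[k] W →ₗ[k] Z :=
  ∑ i, ∑ j, F i j ∘ₗ TensorProduct.map (P i) (Q j)

theorem proj_of_homog {P : ι → Module.End k V} (hP : CompleteOrthogonalIdempotents P) {i : ι}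
    {v : V} (hv : P i v = v) (j : ι) : P j v = if j = i then v else 0 := by
  split_ifs with h
  · rw [h, hv]
  · rw [← hv, ← Module.End.mul_apply, hP.ortho h]; rfl

theorem homog_proj {P : ι → Module.End k V} (hP : CompleteOrthogonalIdempotents P) (i : ι)
    (v : V) : P i (P i v) = P i v := by
  rw [← Module.End.mul_apply, (hP.idem i).eq]

theorem sum_proj {P : ι → Module.End k V} (hP : CompleteOrthogonalIdempotents P) (v : V) :
    ∑ i, P i v = v := by
  rw [← LinearMap.sum_apply, hP.complete]; rfl

theorem homog_ext {P : ι → Module.End k V} (hP : CompleteOrthogonalIdempotents P)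
    {f g : V →ₗ[k] Z} (h : ∀ i v, P i v = v → f v = g v) : f = g := by
  ext v
  rw [← sum_proj hP v, map_sum, map_sum]
  exact Finset.sum_congr rfl fun i _ => h i _ (homog_proj hP i v)

theorem homog_ext₂ {P : ι → Module.End k V} (hP : CompleteOrthogonalIdempotents P)
    {Q : ι → Module.End k W} (hQ : CompleteOrthogonalIdempotents Q)
    {f g : V ⊗[k] W →ₗ[k] Z}
    (h : ∀ i v j w, P i v = v → Q j w = w → f (v ⊗ₜ w) = g (v ⊗ₜ w)) : f = g := by
  apply TensorProduct.ext
  refine homog_ext hP fun i v hv => homog_ext hQ fun j w hw => ?_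
  exact h i v j w hv hw

theorem gradedLift_tmul {P : ι → Module.End k V} (hP : CompleteOrthogonalIdempotents P)
    {Q : ι → Module.End k W} (hQ : CompleteOrthogonalIdempotents Q)
    (F : ι → ι → (V ⊗[k] W →ₗ[k] Z)) {i j : ι} {v : V} {w : W} (hv : P i v = v) (hw : Q j w = w) :
    gradedLift P Q F (v ⊗ₜ w) = F i j (v ⊗ₜ w) := by
  simp only [gradedLift, LinearMap.sum_apply, LinearMap.comp_apply, TensorProduct.map_tmul,
    proj_of_homog hP hv, proj_of_homog hQ hw]
  rw [Finset.sum_eq_single i, Finset.sum_eq_single j] <;> simp +contextual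

/-- The grading of `V ⊗ W` in which `V_i ⊗ W_j` has degree `d i j`. -/
def tensorProj (d : ι → ι → ι) (P : ι → Module.End k V) (Q : ι → Module.End k W) (n : ι) :
    Module.End k (V ⊗[k] W) :=
  gradedLift P Q fun i j => if d i j = n then LinearMap.id else 0

theorem tensorProj_tmul (d : ι → ι → ι) {P : ι → Module.End k V}
    (hP : CompleteOrthogonalIdempotents P)
    {Q : ι → Module.End k W} (hQ : CompleteOrthogonalIdempotents Q)
    {i j : ι} {v : V} {w : W} (hv : P i v = v) (hw : Q j w = w) (n : ι) :
    tensorProj d P Q n (v ⊗ₜ w) = if d i j = n then v ⊗ₜ w else 0 := by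
  rw [tensorProj, gradedLift_tmul hP hQ _ hv hw]
  split_ifs <;> rfl

theorem tensorProj_complete (d : ι → ι → ι) {P : ι → Module.End k V}
    (hP : CompleteOrthogonalIdempotents P)
    {Q : ι → Module.End k W} (hQ : CompleteOrthogonalIdempotents Q) :
    CompleteOrthogonalIdempotents (tensorProj d P Q) := by
  rw [CompleteOrthogonalIdempotents.iff_ortho_complete]
  constructor
  · intro n n' hn
    refine homog_ext₂ hP hQ fun i v j w hv hw => ?_
    rw [Module.End.mul_apply, tensorProj_tmul d hP hQ hv hw]
    split_ifs with h
    · rw [tensorProj_tmul d hP hQ hv hw, if_neg (by rintro rfl; exact hn h)]; rfl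
    · rw [map_zero]; rfl
  · refine homog_ext₂ hP hQ fun i v j w hv hw => ?_
    simp [LinearMap.sum_apply, tensorProj_tmul d hP hQ hv hw]

end Graded

end CosetReps

/-! ### The category `𝒟` -/

section Objects

variable {X : Type u} [Group X] [Finite X] (c : CosetReps X) (k : Type u) [Field k]

/-- The axioms for an object of `𝒟`.  The gradings are given by the projections `proj (a, w)` to
the subspaces `{ξ : ⟨ξ⟩ = a, |ξ| = w}`, of which the space is the direct sum; so
`proj (a, w) ξ = ξ` says that `ξ` is homogeneous with `⟨ξ⟩ = a` and `|ξ| = w`.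
Furthermore `ract u ξ = ξ ◁̄ u` and `lact s ξ = s ▷̄ ξ`. -/
structure IsDObj {V : Type u} [AddCommGroup V] [Module k V] (proj : c.Bideg → Module.End k V)
    (ract : c.G → Module.End k V) (lact : c.M → Module.End k V) : Prop where
  grading : CompleteOrthogonalIdempotents proj
  ract_one : ∀ ξ, ract 1 ξ = ξ
  ract_mul : ∀ u v ξ, ract (u * v) ξ = ract v (ract u ξ)
  /-- `⟨ξ ◁̄ u⟩ = ⟨ξ⟩ ◁ u` and `|ξ ◁̄ u| = (⟨ξ⟩ ▷ u)⁻¹ |ξ| u` -/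
  ract_grade : ∀ a w u ξ, proj (a, w) ξ = ξ →
    proj (c.ra a u, (c.la a u)⁻¹ * w * u) (ract u ξ) = ract u ξ
  lact_one : ∀ ξ, lact 1 ξ = ξ
  /-- `s · ⟨ξ⟩ = ⟨s ▷̄ ξ⟩ · (s ◁ |ξ|)` and
  `τ(s,⟨ξ⟩)⁻¹ (s ▷ |ξ|) = τ(⟨s ▷̄ ξ⟩, s ◁ |ξ|)⁻¹ |s ▷̄ ξ|` -/
  lact_grade : ∀ a w s a' w' ξ, proj (a, w) ξ = ξ →
    c.dot s a = c.dot a' (c.ra s w) →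
    (c.tau s a)⁻¹ * c.la s w = (c.tau a' (c.ra s w))⁻¹ * w' →
    proj (a', w') (lact s ξ) = lact s ξ
  /-- `p ▷̄ (t ▷̄ ξ) = ((p' · t) ▷̄ ξ) ◁̄ τ(p' ◁ (t ▷ |ξ|), t ◁ |ξ|)⁻¹` with
  `p' = p ◁ τ(⟨t ▷̄ ξ⟩, t ◁ |ξ|) τ(t,⟨ξ⟩)⁻¹` -/
  lact_lact : ∀ a w p t p' ξ, proj (a, w) ξ = ξ →
    p' = c.ra p (c.tau (c.lgrade t a w) (c.ra t w) * (c.tau t a)⁻¹) →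
    lact p (lact t ξ) =
      ract (c.tau (c.ra p' (c.la t w)) (c.ra t w))⁻¹ (lact (c.dot p' t) ξ)
  /-- `(s ▷̄ ξ) ◁̄ ((s ◁ |ξ|) ▷ u) = (s ◁ (⟨ξ⟩ ▷ u)) ▷̄ (ξ ◁̄ u)` -/
  cross : ∀ a w s u ξ, proj (a, w) ξ = ξ →
    ract (c.la (c.ra s w) u) (lact s ξ) = lact (c.ra s (c.la a u)) (ract u ξ)

/-- The action of the group `X`: `ξ ◁̂ us = (ξ ◁̄ u) ◁̂ s` for `u ∈ G` and `s ∈ M`, where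
`ξ ◁̂ s = ((s^L ◁ |ξ|⁻¹) ▷̄ ξ) ◁̄ τ(s^L, s)` for homogeneous `ξ`. -/
def hatAct {V : Type u} [AddCommGroup V] [Module k V] (proj : c.Bideg → Module.End k V)
    (ract : c.G → Module.End k V) (lact : c.M → Module.End k V) (x : X) : Module.End k V :=
  (∑ i : c.Bideg, ract (c.tau (c.leftInv (c.mPart x)) (c.mPart x)) ∘ₗ
    lact (c.ra (c.leftInv (c.mPart x)) i.2⁻¹) ∘ₗ proj i) ∘ₗ ract (c.gPart x)

/-- A `Y`-grading (with projections `N`) and a compatible right action `R` of the group `X`. -/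
structure IsDouble {V : Type u} [AddCommGroup V] [Module k V] (N R : X → Module.End k V) :
    Prop where
  R_one : ∀ ξ, R 1 ξ = ξ
  R_mul : ∀ x y ξ, R (x * y) ξ = R y (R x ξ)
  R_grade : ∀ x y ξ, N y ξ = ξ → N (CosetReps.raD y x) (R x ξ) = R x ξ

variable {c k}

section conv

variable {V : Type u} [AddCommGroup V] [Module k V] {proj : c.Bideg → Module.End k V}
    {ract : c.G → Module.End k V} {lact : c.M → Module.End k V}

open CosetReps

/-- A `Y`-grading and an `X`-action give an object of `𝒟`. -/
theorem IsDouble.isDObj {R : X → Module.End k V} (h : IsDouble k (fun y => proj (c.bideg y)) R)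
    (hP : CompleteOrthogonalIdempotents proj) (hr : ∀ u : c.G, ract u = R u)
    (hl : ∀ a w s ξ, proj (a, w) ξ = ξ → lact s ξ = R (c.ra s w : X)⁻¹ ξ) :
    IsDObj c k proj ract lact := by
  have hg : ∀ (i j : c.Bideg) x ξ, proj i ξ = ξ → raD (c.dnorm i) x = c.dnorm j →
      proj j (R x ξ) = R x ξ := by
    intro i j x ξ hξ hj
    have := h.R_grade x (c.dnorm i) ξ (by simpa [c.bideg_dnorm] using hξ)
    rwa [hj, c.bideg_dnorm] at this
  have hgr : ∀ a w s a' w' ξ, proj (a, w) ξ = ξ →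
      c.dot s a = c.dot a' (c.ra s w) →
      (c.tau s a)⁻¹ * c.la s w = (c.tau a' (c.ra s w))⁻¹ * w' →
      proj (a', w') (lact s ξ) = lact s ξ := by
    intro a w s a' w' ξ hξ h1 h2
    rw [hl a w s ξ hξ]
    refine hg (a, w) (a', w') _ _ hξ ?_
    have e1 : (c.tau s a : X)⁻¹ * (s * a) = (c.tau a' (c.ra s w) : X)⁻¹ * (a' * c.ra s w) := by
      have := congrArg (Subtype.val) h1
      simpa [dot, tau, coe_gPart, mul_assoc] using this
    have e2 := congrArg (Subtype.val) h2
    have e3 : (s : X) * w = c.la s w * c.ra s w := by simp [la, ra, gPart_mul_mPart]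
    simp only [Subgroup.coe_mul, Subgroup.coe_inv] at e2
    have e4 : (w' : X) = (c.tau a' (c.ra s w) : X) * (c.tau s a : X)⁻¹ * c.la s w := by
      rw [mul_assoc, e2]; group
    have e5 : (a' : X) = (c.tau a' (c.ra s w) : X) * (c.tau s a : X)⁻¹ * (s * a) *
        (c.ra s w : X)⁻¹ := by
      rw [mul_assoc _ _ (_ * _), e1]; group
    have e6 : (c.la s w : X) = s * w * (c.ra s w : X)⁻¹ := by rw [e3]; group
    simp only [raD, dnorm]
    rw [e4, e5, e6]; group
  refine ⟨hP, fun ξ => ?_, fun u v ξ => ?_, ?_, fun ξ => ?_, hgr, ?_, ?_⟩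
  · rw [hr]; exact h.R_one ξ
  · rw [hr, hr, hr, Subgroup.coe_mul, h.R_mul]
  · intro a w u ξ hξ
    rw [hr]
    refine hg (a, w) _ _ _ hξ ?_
    simp only [raD, dnorm, la, ra, Subgroup.coe_mul, Subgroup.coe_inv, coe_gPart]; group
  · rw [← sum_proj hP ξ, map_sum]
    refine Finset.sum_congr rfl fun i _ => ?_
    rw [hl i.1 i.2 1 _ (homog_proj hP i ξ)]
    have : c.ra 1 i.2 = 1 := by simp [ra, mPart_coeG]
    rw [this]; simp [h.R_one]
  · intro a w p t p' ξ hξ hp'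
    have key : (c.tau t a)⁻¹ * c.la t w = (c.tau (c.lgrade t a w) (c.ra t w))⁻¹ *
        (c.tau (c.lgrade t a w) (c.ra t w) * (c.tau t a)⁻¹ * c.la t w) := by group
    have h1 := hgr a w t (c.lgrade t a w) _ ξ hξ (by rw [lgrade, dot_rightDiv]) key
    rw [hl _ _ p _ h1, hl a w t ξ hξ, hl a w _ ξ hξ, hr, ← h.R_mul, ← h.R_mul]
    congr 2
    have hp : c.ra p (c.tau (c.lgrade t a w) (c.ra t w) * (c.tau t a)⁻¹ * c.la t w) =
        c.ra p' (c.la t w) := by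
      rw [hp']; simp only [ra, mPart_mul_mul, Subgroup.coe_mul, mul_assoc]
    have hd : c.ra (c.dot p' t) w = c.dot (c.ra p' (c.la t w)) (c.ra t w) := by
      simp only [ra, dot, mPart_mul_mul, la, mul_assoc, gPart_mul_mPart]
    rw [hp, hd]
    simp only [Subgroup.coe_inv, tau, dot, coe_gPart]; group
  · intro a w s u ξ hξ
    have h1 : proj (c.ra a u, (c.la a u)⁻¹ * w * u) (ract u ξ) = ract u ξ := by
      rw [hr]
      refine hg (a, w) _ _ _ hξ ?_
      simp only [raD, dnorm, la, ra, Subgroup.coe_mul, Subgroup.coe_inv, coe_gPart]; group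
    rw [hl _ _ _ _ h1, hl a w s ξ hξ, hr, hr, ← h.R_mul, ← h.R_mul]
    congr 2
    have : c.ra (c.ra s (c.la a u)) ((c.la a u)⁻¹ * w * u) = c.ra (c.ra s w) u := by
      simp only [ra, mPart_mul_mul, Subgroup.coe_mul, Subgroup.coe_inv]
      congr 1; group
    rw [this]
    simp only [la, ra, coe_gPart]; group

theorem hatAct_homog (h : IsDObj c k proj ract lact) {a : c.M} {w : c.G} {ξ : V} (x : X)
    (hξ : proj (a, w) ξ = ξ) : hatAct c k proj ract lact x ξ =
      ract (c.tau (c.leftInv (c.mPart x)) (c.mPart x))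
        (lact (c.ra (c.leftInv (c.mPart x)) ((c.la a (c.gPart x))⁻¹ * w * c.gPart x)⁻¹)
          (ract (c.gPart x) ξ)) := by
  have h1 := h.ract_grade a w (c.gPart x) ξ hξ
  simp only [hatAct, LinearMap.comp_apply, LinearMap.sum_apply, proj_of_homog h.grading h1]
  rw [Finset.sum_eq_single (c.ra a (c.gPart x), (c.la a (c.gPart x))⁻¹ * w * c.gPart x)] <;>
    simp +contextual

/-- The `X`-action in terms of the factorisation of `x⁻¹`. -/
theorem hatAct_eq (h : IsDObj c k proj ract lact) {a : c.M} {w : c.G} {ξ : V} (x : X)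
    (hξ : proj (a, w) ξ = ξ) : hatAct c k proj ract lact x ξ =
      ract (c.gPart x⁻¹)⁻¹ (lact (c.ra (c.mPart x⁻¹) w⁻¹) ξ) := by
  rw [hatAct_homog h x hξ]
  set s := c.mPart x with hs
  set v := c.gPart x with hv
  have hx : x = v * s := (c.gPart_mul_mPart x).symm
  have hu := c.parts_unique (x := x⁻¹)
    (u := (c.tau (c.leftInv s) s)⁻¹ * c.la (c.leftInv s) v⁻¹)
    (s := c.ra (c.leftInv s) v⁻¹) (by
      simp only [tau, la, ra, Subgroup.coe_mul, Subgroup.coe_inv, mul_assoc, gPart_mul_mPart]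
      have : c.mPart ((c.leftInv s : X) * s) = 1 := c.dot_leftInv s
      rw [coe_gPart, this, hx]; simp)
  have hc := h.cross a w (c.ra (c.ra (c.leftInv s) v⁻¹) w⁻¹) v ξ hξ
  have e1 : c.ra (c.ra (c.ra (c.leftInv s) v⁻¹) w⁻¹) (c.la a v) =
      c.ra (c.leftInv s) ((c.la a v)⁻¹ * w * v)⁻¹ := by
    simp only [ra, mPart_mul_mul, Subgroup.coe_mul, Subgroup.coe_inv]
    congr 1; group
  have e2 : c.ra (c.ra (c.ra (c.leftInv s) v⁻¹) w⁻¹) w = c.ra (c.leftInv s) v⁻¹ := by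
    simp only [ra, mPart_mul_mul, Subgroup.coe_inv]
    congr 1; group
  rw [e1, e2] at hc
  rw [← hc, hu.1, hu.2, ← h.ract_mul]
  congr 2
  apply Subtype.ext
  simp only [Subgroup.coe_mul, Subgroup.coe_inv, la, ra, coe_gPart, mPart_mul_mul]
  group
  simp [mPart_coe]

theorem IsDObj.lact_homog (h : IsDObj c k proj ract lact) {a : c.M} {w : c.G} {ξ : V} (s : c.M)
    (hξ : proj (a, w) ξ = ξ) :
    proj (c.lgrade s a w, c.tau (c.lgrade s a w) (c.ra s w) * (c.tau s a)⁻¹ * c.la s w)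
      (lact s ξ) = lact s ξ :=
  h.lact_grade a w s _ _ ξ hξ (by rw [lgrade, dot_rightDiv]) (by group)

theorem hatAct_homog_homog (h : IsDObj c k proj ract lact) {i : c.Bideg} {ξ : V} (x : X)
    (hξ : proj i ξ = ξ) : proj (c.bideg (raD (c.dnorm i) x)) (hatAct c k proj ract lact x ξ) =
      hatAct c k proj ract lact x ξ := by
  obtain ⟨a, w⟩ := i
  rw [hatAct_eq h x hξ]
  set σ := c.mPart x⁻¹ with hs
  set v := c.gPart x⁻¹ with hv
  have hx : x = (v * σ : X)⁻¹ := by rw [c.gPart_mul_mPart]; simp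
  have h1 := h.ract_grade _ _ v⁻¹ _ (h.lact_homog (c.ra σ w⁻¹) hξ)
  have e2 : c.ra (c.ra σ w⁻¹) w = σ := by
    simp only [ra, mPart_mul_mul, Subgroup.coe_inv]
    simp [mPart_coe]
  have h3 : ∀ j, raD (c.dnorm (a, w)) x = c.dnorm j → c.bideg (raD (c.dnorm (a, w)) x) = j := by
    intro j hj; rw [hj, bideg_dnorm]
  rw [h3 _ ?_]
  · exact h1
  · rw [e2]
    simp only [lgrade, e2]
    set t := c.ra σ w⁻¹ with ht
    have e5 : c.dot (c.rightDiv (c.dot t a) σ) σ = c.dot t a := dot_rightDiv _ _ _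
    set a' := c.rightDiv (c.dot t a) σ
    have e6 : (c.tau a' σ : X)⁻¹ * (a' * σ) = (c.tau t a : X)⁻¹ * (t * a) := by
      have := congrArg (Subtype.val) e5
      simpa [dot, tau, coe_gPart, mul_assoc] using this
    have e7 : (a' : X) = c.tau a' σ * ((c.tau t a : X)⁻¹ * (t * a)) * (σ : X)⁻¹ := by
      rw [← e6]; group
    have e8 : (c.la t w : X) = t * w * (σ : X)⁻¹ := by
      rw [la, coe_gPart, ← e2]; rfl
    have e9 : (c.la a' v⁻¹ : X) = a' * (v : X)⁻¹ * (c.ra a' v⁻¹ : X)⁻¹ := by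
      rw [la, coe_gPart]; rfl
    simp only [raD, dnorm, Subgroup.coe_mul, Subgroup.coe_inv, e9, e8]
    rw [hx]
    generalize hT : (c.tau a' σ : X) = T at e7 ⊢
    generalize (c.ra a' v⁻¹ : X) = Q
    rw [e7]; group

theorem hatAct_isDouble (h : IsDObj c k proj ract lact) :
    IsDouble k (fun y => proj (c.bideg y)) (hatAct c k proj ract lact) where
  R_one ξ := by
    rw [← sum_proj h.grading ξ, map_sum]
    refine Finset.sum_congr rfl fun i _ => ?_
    rw [hatAct_eq h (a := i.1) (w := i.2) 1 (homog_proj h.grading i ξ)]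
    have := c.parts_unique (x := (1 : X)⁻¹) (u := 1) (s := 1) (by simp)
    rw [this.1, this.2, inv_one, h.ract_one]
    have : c.ra 1 i.2⁻¹ = 1 := by
      simpa [ra] using c.mPart_coeG i.2⁻¹
    rw [this, h.lact_one]
  R_grade x y ξ hξ := by
    have := hatAct_homog_homog h x hξ
    rwa [dnorm_bideg] at this
  R_mul x y ξ := by
    rw [← sum_proj h.grading ξ, map_sum, map_sum, map_sum]
    refine Finset.sum_congr rfl fun i _ => ?_
    obtain ⟨a, w⟩ := i
    have hξ := homog_proj h.grading (a, w) ξ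
    set ζ := proj (a, w) ξ
    clear_value ζ
    rw [hatAct_eq h x hξ, hatAct_eq h (x * y) hξ]
    set σ := c.mPart x⁻¹ with hs
    set v := c.gPart x⁻¹ with hv
    set t := c.ra σ w⁻¹ with ht
    have h1 := h.lact_homog t hξ
    have e2 : c.ra t w = σ := by
      simp only [t, ra, mPart_mul_mul, Subgroup.coe_inv]
      simp [mPart_coe]
    set a' := c.lgrade t a w with ha'
    set w' := c.tau a' (c.ra t w) * (c.tau t a)⁻¹ * c.la t w with hw'
    rw [hatAct_eq h y (h.ract_grade _ _ v⁻¹ _ h1)]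
    set π := c.mPart y⁻¹ with hp
    set g := c.gPart y⁻¹ with hg
    have hc := h.cross _ _ (c.ra π (v * w'⁻¹)) v⁻¹ _ h1
    have e3 : c.ra (c.ra π (v * w'⁻¹)) (c.la a' v⁻¹) =
        c.ra π ((c.la a' v⁻¹)⁻¹ * w' * v⁻¹)⁻¹ := by
      simp only [ra, mPart_mul_mul, Subgroup.coe_inv, Subgroup.coe_mul]
      congr 1; group
    have e4 : c.ra (c.ra π (v * w'⁻¹)) w' = c.ra π v := by
      simp only [ra, mPart_mul_mul, Subgroup.coe_inv, Subgroup.coe_mul]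
      congr 1; group
    rw [e3, e4] at hc
    rw [← hc, h.lact_lact a w _ t _ ζ hξ rfl, ← h.ract_mul, ← h.ract_mul]
    have e5 : c.ra (c.ra (c.ra π (v * w'⁻¹)) (c.tau a' (c.ra t w) * (c.tau t a)⁻¹)) (c.la t w) =
        c.ra π v := by
      rw [← e4, hw']
      simp only [ra, mPart_mul_mul, Subgroup.coe_inv, Subgroup.coe_mul, mul_assoc]
    have e6 : c.dot (c.ra (c.ra π (v * w'⁻¹)) (c.tau a' (c.ra t w) * (c.tau t a)⁻¹)) t =
        c.ra (c.dot (c.ra π v) σ) w⁻¹ := by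
      rw [← e5]
      generalize (c.ra (c.ra π (v * w'⁻¹)) (c.tau a' (c.ra t w) * (c.tau t a)⁻¹)) = p'
      have : (c.la t w : X) = t * w * (σ : X)⁻¹ := by
        rw [la, coe_gPart, ← e2]; rfl
      simp only [ra, dot, mPart_mul_mul, Subgroup.coe_inv, this]
      congr 1; group
    rw [← ha', e5, e6, e2]
    have hu := c.parts_unique (x := (x * y)⁻¹)
      (u := g * c.la π v * c.tau (c.ra π v) σ) (s := c.dot (c.ra π v) σ) (by
        simp only [tau, la, dot, Subgroup.coe_mul, mul_assoc, gPart_mul_mPart, ra]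
        rw [← mul_assoc (c.gPart (π * v) : X), gPart_mul_mPart, mul_inv_rev,
          ← c.gPart_mul_mPart x⁻¹, ← c.gPart_mul_mPart y⁻¹]
        simp only [mul_assoc, ← hp, ← hg, ← hs, ← hv])
    rw [hu.1, hu.2]
    congr 2
    apply Subtype.ext
    simp only [Subgroup.coe_mul, Subgroup.coe_inv, la, ra, coe_gPart, mPart_mul_mul, tau]
    group
    simp [mPart_coe]

theorem hatAct_coe (h : IsDObj c k proj ract lact) (u : c.G) :
    ract u = hatAct c k proj ract lact u := by
  refine homog_ext h.grading fun i ξ hξ => ?_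
  rw [hatAct_eq h (a := i.1) (w := i.2) u hξ]
  have := c.parts_unique (x := (u : X)⁻¹) (u := u⁻¹) (s := 1) (by simp)
  rw [this.1, this.2, inv_inv]
  have : c.ra 1 i.2⁻¹ = 1 := by simpa [ra] using c.mPart_coeG i.2⁻¹
  rw [this, h.lact_one]

theorem lact_eq_hatAct (h : IsDObj c k proj ract lact) {i : c.Bideg} {ξ : V} (s : c.M)
    (hξ : proj i ξ = ξ) :
    lact s ξ = hatAct c k proj ract lact (c.ra s i.2 : X)⁻¹ ξ := by
  rw [hatAct_eq h (a := i.1) (w := i.2) _ hξ, inv_inv, gPart_coe, mPart_coe, inv_one, h.ract_one]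
  congr 2
  simp only [ra, mPart_mul_mul, Subgroup.coe_inv]
  simp [mPart_coe]

end conv

end Objects

section Category

variable {X : Type u} [Group X] [Finite X] (c : CosetReps X) (k : Type u) [Field k]

open CosetReps

/-- Objects of `𝒟`: finite-dimensional vector spaces with `M`- and `G`-gradings, a right action
`ract u ξ = ξ ◁̄ u` of `G` and an action `lact s ξ = s ▷̄ ξ` of `M`. -/
structure DObj where
  carrier : Type u
  [addCommGroup : AddCommGroup carrier]
  [module : Module k carrier]
  [finite : Module.Finite k carrier]
  proj : c.Bideg → Module.End k carrier
  ract : c.G → Module.End k carrier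
  lact : c.M → Module.End k carrier
  isDObj : IsDObj c k proj ract lact

attribute [instance] DObj.addCommGroup DObj.module DObj.finite

namespace DObj

variable {c k}

/-- The action `ξ ◁̂ x` of the group `X` on an object. -/
def hat (V : DObj c k) (x : X) : Module.End k V.carrier := hatAct c k V.proj V.ract V.lact x

/-- The projection to `{ξ : ‖ξ‖ = y}`. -/
def dproj (V : DObj c k) (y : X) : Module.End k V.carrier := V.proj (c.bideg y)

theorem hat_isDouble (V : DObj c k) : IsDouble k V.dproj V.hat := hatAct_isDouble V.isDObj

theorem ract_eq (V : DObj c k) (u : c.G) : V.ract u = V.hat u := hatAct_coe V.isDObj u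

theorem lact_eq (V : DObj c k) {i : c.Bideg} {ξ : V.carrier} (s : c.M) (hξ : V.proj i ξ = ξ) :
    V.lact s ξ = V.hat (c.ra s i.2 : X)⁻¹ ξ := lact_eq_hatAct V.isDObj s hξ

theorem hat_mul (V : DObj c k) (x y : X) (ξ : V.carrier) : V.hat (x * y) ξ = V.hat y (V.hat x ξ) :=
  V.hat_isDouble.R_mul x y ξ

theorem hat_one (V : DObj c k) (ξ : V.carrier) : V.hat 1 ξ = ξ := V.hat_isDouble.R_one ξ

theorem hat_homog (V : DObj c k) {i : c.Bideg} {ξ : V.carrier} (x : X) (hξ : V.proj i ξ = ξ) :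
    V.proj (c.bideg (raD (c.dnorm i) x)) (V.hat x ξ) = V.hat x ξ :=
  hatAct_homog_homog V.isDObj x hξ

theorem hat_unique (V : DObj c k) {R : X → Module.End k V.carrier}
    (h : IsDouble k V.dproj R) (hr : ∀ u : c.G, V.ract u = R u)
    (hl : ∀ a w s ξ, V.proj (a, w) ξ = ξ → V.lact s ξ = R (c.ra s w : X)⁻¹ ξ) (x : X) :
    V.hat x = R x := by
  refine homog_ext V.isDObj.grading fun i ξ hξ => ?_
  rw [hat, hatAct_eq V.isDObj (a := i.1) (w := i.2) x hξ, hl i.1 i.2 _ ξ hξ, hr, ← h.R_mul]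
  congr 2
  have : c.ra (c.ra (c.mPart x⁻¹) i.2⁻¹) i.2 = c.mPart x⁻¹ := by
    simp only [ra, mPart_mul_mul, Subgroup.coe_inv]
    simp
  rw [this]
  have h2 := c.gPart_mul_mPart x⁻¹
  rw [Subgroup.coe_inv, ← mul_inv_rev, h2, inv_inv]

/-- Morphisms of `𝒟`: linear maps preserving both gradings and both actions. -/
@[ext] structure Hom (V W : DObj c k) where
  lin : V.carrier →ₗ[k] W.carrier
  map_proj : ∀ i ξ, lin (V.proj i ξ) = W.proj i (lin ξ)
  map_ract : ∀ u ξ, lin (V.ract u ξ) = W.ract u (lin ξ)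
  map_lact : ∀ s ξ, lin (V.lact s ξ) = W.lact s (lin ξ)

instance : Category (DObj c k) where
  Hom V W := Hom V W
  id V := ⟨LinearMap.id, fun _ _ => rfl, fun _ _ => rfl, fun _ _ => rfl⟩
  comp f g := ⟨g.lin ∘ₗ f.lin, fun i ξ => by simp [f.map_proj, g.map_proj],
    fun i ξ => by simp [f.map_ract, g.map_ract], fun i ξ => by simp [f.map_lact, g.map_lact]⟩

@[ext] theorem hom_ext {V W : DObj c k} {f g : V ⟶ W} (h : Hom.lin f = Hom.lin g) : f = g :=
  Hom.ext h

@[simp] theorem lin_id (V : DObj c k) : Hom.lin (𝟙 V) = LinearMap.id := rfl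

@[simp] theorem lin_comp {U V W : DObj c k} (f : U ⟶ V) (g : V ⟶ W) :
    Hom.lin (f ≫ g) = Hom.lin g ∘ₗ Hom.lin f := rfl

theorem Hom.map_hat {V W : DObj c k} (f : V ⟶ W) (x : X) (ξ : V.carrier) :
    Hom.lin f (V.hat x ξ) = W.hat x (Hom.lin f ξ) := by
  simp [hat, hatAct, Hom.map_proj, Hom.map_ract, Hom.map_lact]

theorem Hom.map_homog {V W : DObj c k} (f : V ⟶ W) {i : c.Bideg} {ξ : V.carrier}
    (h : V.proj i ξ = ξ) : W.proj i (Hom.lin f ξ) = Hom.lin f ξ := by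
  rw [← Hom.map_proj, h]

/-- A linear map preserving `‖ ‖` and the `X`-action is a morphism. -/
def homMk {V W : DObj c k} (f : V.carrier →ₗ[k] W.carrier)
    (h1 : ∀ i, f ∘ₗ V.proj i = W.proj i ∘ₗ f)
    (h2 : ∀ x, f ∘ₗ V.hat x = W.hat x ∘ₗ f) : V ⟶ W where
  lin := f
  map_proj i ξ := LinearMap.congr_fun (h1 i) ξ
  map_ract u ξ := by rw [ract_eq, ract_eq]; exact LinearMap.congr_fun (h2 _) ξ
  map_lact s ξ := by
    have : f ∘ₗ V.lact s = W.lact s ∘ₗ f := by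
      refine homog_ext V.isDObj.grading fun i ξ hξ => ?_
      have hf : W.proj i (f ξ) = f ξ := by
        have := LinearMap.congr_fun (h1 i) ξ
        simp only [LinearMap.comp_apply, hξ] at this
        exact this.symm
      simp only [LinearMap.comp_apply, lact_eq V s hξ, lact_eq W s hf]
      exact LinearMap.congr_fun (h2 _) ξ
    exact LinearMap.congr_fun this ξ

/-- An invertible linear map preserving `‖ ‖` and the `X`-action is an isomorphism. -/
def isoMk {V W : DObj c k} (f : V.carrier ≃ₗ[k] W.carrier)
    (h1 : ∀ i, f.toLinearMap ∘ₗ V.proj i = W.proj i ∘ₗ f.toLinearMap)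
    (h2 : ∀ x, f.toLinearMap ∘ₗ V.hat x = W.hat x ∘ₗ f.toLinearMap) : V ≅ W where
  hom := homMk f.toLinearMap h1 h2
  inv := homMk f.symm.toLinearMap
    (fun i => LinearMap.ext fun ξ => by
      have := LinearMap.congr_fun (h1 i) (f.symm ξ)
      simp only [LinearMap.comp_apply, LinearEquiv.coe_coe, LinearEquiv.apply_symm_apply] at this ⊢
      rw [← this, LinearEquiv.symm_apply_apply])
    (fun x => LinearMap.ext fun ξ => by
      have := LinearMap.congr_fun (h2 x) (f.symm ξ)
      simp only [LinearMap.comp_apply, LinearEquiv.coe_coe, LinearEquiv.apply_symm_apply] at this ⊢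
      rw [← this, LinearEquiv.symm_apply_apply])
  hom_inv_id := hom_ext (LinearMap.ext fun ξ => f.symm_apply_apply ξ)
  inv_hom_id := hom_ext (LinearMap.ext fun ξ => f.apply_symm_apply ξ)

/-! #### The tensor product -/

/-- `(ξ ⊗ η) ◁̄ u = ξ ◁̄ (⟨η⟩ ▷ u) ⊗ η ◁̄ u` -/
def tensorRact (V W : DObj c k) (u : c.G) : Module.End k (V.carrier ⊗[k] W.carrier) :=
  gradedLift V.proj W.proj fun _ j => TensorProduct.map (V.ract (c.la j.1 u)) (W.ract u)

/-- `(s ◁ τ(⟨ξ⟩,⟨η⟩)) ▷̄ (ξ ⊗ η) =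
(s ▷̄ ξ) ◁̄ τ(s ◁ |ξ|, ⟨η⟩) τ(⟨(s ◁ |ξ|) ▷̄ η⟩, s ◁ |ξ||η|)⁻¹ ⊗ (s ◁ |ξ|) ▷̄ η`;
below, `s` in this formula is replaced by `s ◁ τ(⟨ξ⟩,⟨η⟩)⁻¹`. -/
def tensorLact (V W : DObj c k) (s : c.M) : Module.End k (V.carrier ⊗[k] W.carrier) :=
  gradedLift V.proj W.proj fun i j =>
    let s₀ := c.ra s (c.tau i.1 j.1)⁻¹
    TensorProduct.map
      (V.ract (c.tau (c.ra s₀ i.2) j.1 *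
        (c.tau (c.lgrade (c.ra s₀ i.2) j.1 j.2) (c.ra s₀ (i.2 * j.2)))⁻¹) ∘ₗ V.lact s₀)
      (W.lact (c.ra s₀ i.2))

/-- `(ξ ⊗ η) ◁̂ x = ξ ◁̂ (‖η‖ ▷̃ x) ⊗ η ◁̂ x` -/
def tensorHat (V W : DObj c k) (x : X) : Module.End k (V.carrier ⊗[k] W.carrier) :=
  gradedLift V.proj W.proj fun _ j => TensorProduct.map (V.hat (c.laD (c.dnorm j) x)) (W.hat x)

theorem tensorHat_tmul (V W : DObj c k) {i j : c.Bideg} {ξ : V.carrier} {η : W.carrier}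
    (hξ : V.proj i ξ = ξ) (hη : W.proj j η = η) (x : X) :
    tensorHat V W x (ξ ⊗ₜ η) = V.hat (c.laD (c.dnorm j) x) ξ ⊗ₜ W.hat x η := by
  rw [tensorHat, gradedLift_tmul V.isDObj.grading W.isDObj.grading _ hξ hη, TensorProduct.map_tmul]

theorem tensorHat_isDouble (V W : DObj c k) :
    IsDouble k (fun y => tensorProj c.tdeg V.proj W.proj (c.bideg y)) (tensorHat V W) := by
  have hV := V.isDObj.grading
  have hW := W.isDObj.grading
  refine ⟨fun ζ => ?_, fun x y ζ => ?_, fun x y ζ hζ => ?_⟩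
  · suffices tensorHat V W 1 = LinearMap.id from LinearMap.congr_fun this ζ
    refine homog_ext₂ hV hW fun i ξ j η hξ hη => ?_
    rw [tensorHat_tmul V W hξ hη]
    have : c.laD (c.dnorm j) 1 = 1 := by simp [laD, raD]
    simp [this, hat_one]
  · suffices tensorHat V W (x * y) = tensorHat V W y ∘ₗ tensorHat V W x from
      LinearMap.congr_fun this ζ
    refine homog_ext₂ hV hW fun i ξ j η hξ hη => ?_
    rw [LinearMap.comp_apply, tensorHat_tmul V W hξ hη, tensorHat_tmul V W hξ hη,
      tensorHat_tmul V W (hat_homog V _ hξ) (hat_homog W _ hη), dnorm_bideg, laD_mul, hat_mul,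
      hat_mul]
  · suffices tensorProj c.tdeg V.proj W.proj (c.bideg (raD y x)) ∘ₗ tensorHat V W x ∘ₗ
        tensorProj c.tdeg V.proj W.proj (c.bideg y) =
        tensorHat V W x ∘ₗ tensorProj c.tdeg V.proj W.proj (c.bideg y) by
      have := LinearMap.congr_fun this ζ
      simpa only [LinearMap.comp_apply, hζ] using this
    refine homog_ext₂ hV hW fun i ξ j η hξ hη => ?_
    simp only [LinearMap.comp_apply]
    rw [tensorProj_tmul _ hV hW hξ hη]
    split_ifs with h
    · rw [tensorHat_tmul V W hξ hη,
        tensorProj_tmul _ hV hW (hat_homog V _ hξ) (hat_homog W _ hη), if_pos]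
      rw [← bideg_circ, ← raD_circ, circ_dnorm, h, dnorm_bideg]
    · simp

theorem tensorRact_eq (V W : DObj c k) (u : c.G) : tensorRact V W u = tensorHat V W u := by
  refine homog_ext₂ V.isDObj.grading W.isDObj.grading fun i ξ j η hξ hη => ?_
  rw [tensorHat_tmul V W hξ hη, tensorRact,
    gradedLift_tmul V.isDObj.grading W.isDObj.grading _ hξ hη, TensorProduct.map_tmul,
    ract_eq, ract_eq]
  congr 3
  have : c.mPart (raD (c.dnorm j) u) = c.ra j.1 u := by
    have := c.mPart_inv_mul u (c.dnorm j * u)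
    rw [← mul_assoc] at this
    rw [raD, this, dnorm, ra, mul_assoc, mPart_inv_mul]
  rw [laD, this, mPart_dnorm, la, coe_gPart]; rfl

theorem tensorLact_eq (V W : DObj c k) (s : c.M) : tensorLact V W s =
    ∑ n, tensorHat V W (c.ra s n.2 : X)⁻¹ ∘ₗ tensorProj c.tdeg V.proj W.proj n := by
  have hV := V.isDObj.grading
  have hW := W.isDObj.grading
  refine homog_ext₂ hV hW fun i ξ j η hξ hη => ?_
  rw [LinearMap.sum_apply, Finset.sum_eq_single (c.tdeg i j)]
  rotate_left
  · intro n _ hn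
    rw [LinearMap.comp_apply, tensorProj_tmul _ hV hW hξ hη, if_neg (Ne.symm hn), map_zero]
  · simp
  rw [LinearMap.comp_apply, tensorProj_tmul _ hV hW hξ hη, if_pos rfl, tensorHat_tmul V W hξ hη,
    tensorLact, gradedLift_tmul hV hW _ hξ hη, TensorProduct.map_tmul, LinearMap.comp_apply,
    lact_eq V _ hξ, lact_eq W _ hη, ract_eq, ← hat_mul]
  set q := c.ra (c.ra s (c.tau i.1 j.1)⁻¹) i.2 with hq
  have e1 : c.ra (c.ra s (c.tau i.1 j.1)⁻¹) (i.2 * j.2) = c.ra q j.2 := by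
    simp only [q, ra, mPart_mul_mul, Subgroup.coe_mul, mul_assoc]
  have e2 : c.ra s (c.tdeg i j).2 = c.ra q j.2 := by
    simp only [q, ra, tdeg, mPart_mul_mul, Subgroup.coe_mul, mul_assoc]
  rw [e1, e2]
  congr 3
  set r := c.ra q j.2 with hr
  have e3 : c.mPart (raD (c.dnorm j) (r : X)⁻¹) = c.lgrade q j.1 j.2 := by
    rw [lgrade, rightDiv, ← hr, dot, mPart_mul_mul, raD, inv_inv, dnorm, hr, ra]
    simp only [mul_assoc]
    rw [mPart_mul_mul]
    congr 1; group
  have e4 : c.dot (c.lgrade q j.1 j.2) r = c.dot q j.1 := by rw [lgrade, ← hr, dot_rightDiv]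
  rw [laD, e3, mPart_dnorm, Subgroup.coe_mul, Subgroup.coe_inv, tau, tau, coe_gPart, coe_gPart]
  change _ * (_ * (c.dot q j.1 : X)⁻¹ * (_ * (c.dot (c.lgrade q j.1 j.2) r : X)⁻¹)⁻¹) = _
  rw [e4]; group

theorem tensorLact_homog (V W : DObj c k) (a : c.M) (w : c.G) (s : c.M)
    (ζ : V.carrier ⊗[k] W.carrier) (hζ : tensorProj c.tdeg V.proj W.proj (a, w) ζ = ζ) :
    tensorLact V W s ζ = tensorHat V W (c.ra s w : X)⁻¹ ζ := by
  rw [tensorLact_eq, LinearMap.sum_apply, Finset.sum_eq_single (a, w)]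
  · rw [LinearMap.comp_apply, hζ]
  · intro n _ hn
    rw [LinearMap.comp_apply, proj_of_homog
      (tensorProj_complete c.tdeg V.isDObj.grading W.isDObj.grading) hζ, if_neg hn, map_zero]
  · simp

/-- The tensor product in `𝒟`. -/
abbrev tensor (V W : DObj c k) : DObj c k where
  carrier := V.carrier ⊗[k] W.carrier
  proj := tensorProj c.tdeg V.proj W.proj
  ract := tensorRact V W
  lact := tensorLact V W
  isDObj := (tensorHat_isDouble V W).isDObj
    (tensorProj_complete _ V.isDObj.grading W.isDObj.grading) (tensorRact_eq V W)
    (tensorLact_homog V W)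

theorem tensor_hat (V W : DObj c k) (x : X) : (tensor V W).hat x = tensorHat V W x :=
  hat_unique (tensor V W) (tensorHat_isDouble V W) (tensorRact_eq V W) (tensorLact_homog V W) x

variable (c k) in
/-- The unit object: `k` with trivial gradings and actions. -/
abbrev unit : DObj c k where
  carrier := k
  proj i := if i = (1, 1) then LinearMap.id else 0
  ract _ := LinearMap.id
  lact _ := LinearMap.id
  isDObj := by
    have hb : c.bideg 1 = (1, 1) := by
      have := c.parts_unique (x := (1 : X)) (u := 1) (s := 1) (by simp)
      simp [bideg, this]
    refine IsDouble.isDObj (R := fun _ => LinearMap.id) ⟨fun _ => rfl, fun _ _ _ => rfl, ?_⟩ ?_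
      (fun _ => rfl) (fun _ _ _ _ _ => rfl)
    · intro x y ξ hξ
      by_cases hy : c.bideg y = (1, 1)
      · have : y = 1 := by rw [← c.dnorm_bideg y, hy]; simp [dnorm]
        subst this
        simp [raD, hb]
      · simp only [if_neg hy] at hξ
        rw [LinearMap.id_apply, ← hξ]; simp
    · rw [CompleteOrthogonalIdempotents.iff_ortho_complete]
      constructor
      · intro i j hij
        split_ifs with h1 h2
        · exact absurd (h1.trans h2.symm) hij
        all_goals simp
      · simp; rfl

/-! #### Elements of given `‖ ‖` -/

theorem ext_homog {V : DObj c k} {Z : Type*} [AddCommGroup Z] [Module k Z]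
    {f g : V.carrier →ₗ[k] Z} (h : ∀ y ξ, V.dproj y ξ = ξ → f ξ = g ξ) : f = g :=
  homog_ext V.isDObj.grading fun i ξ hξ => h (c.dnorm i) ξ (by rw [dproj, bideg_dnorm, hξ])

theorem ext_homog₂ {V W : DObj c k} {Z : Type*} [AddCommGroup Z] [Module k Z]
    {f g : V.carrier ⊗[k] W.carrier →ₗ[k] Z}
    (h : ∀ y ξ z η, V.dproj y ξ = ξ → W.dproj z η = η → f (ξ ⊗ₜ η) = g (ξ ⊗ₜ η)) : f = g :=
  TensorProduct.ext (ext_homog fun y ξ hξ => ext_homog fun z η hη => h y ξ z η hξ hη)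

theorem ext_homog₃ {U V W : DObj c k} {Z : Type*} [AddCommGroup Z] [Module k Z]
    {f g : (U.carrier ⊗[k] V.carrier) ⊗[k] W.carrier →ₗ[k] Z}
    (h : ∀ x ξ y η z ζ, U.dproj x ξ = ξ → V.dproj y η = η → W.dproj z ζ = ζ →
      f ((ξ ⊗ₜ η) ⊗ₜ ζ) = g ((ξ ⊗ₜ η) ⊗ₜ ζ)) : f = g :=
  TensorProduct.ext (ext_homog₂ fun x ξ y η hξ hη => ext_homog fun z ζ hζ =>
    h x ξ y η z ζ hξ hη hζ)

theorem ext_homog₃' {U V W : DObj c k} {Z : Type*} [AddCommGroup Z] [Module k Z]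
    {f g : U.carrier ⊗[k] (V.carrier ⊗[k] W.carrier) →ₗ[k] Z}
    (h : ∀ x ξ y η z ζ, U.dproj x ξ = ξ → V.dproj y η = η → W.dproj z ζ = ζ →
      f (ξ ⊗ₜ (η ⊗ₜ ζ)) = g (ξ ⊗ₜ (η ⊗ₜ ζ))) : f = g :=
  TensorProduct.ext (ext_homog fun x ξ hξ => ext_homog₂ fun y η z ζ hη hζ =>
    h x ξ y η z ζ hξ hη hζ)

theorem dproj_hat (V : DObj c k) {y : X} {ξ : V.carrier} (hξ : V.dproj y ξ = ξ) (x : X) :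
    V.dproj (raD y x) (V.hat x ξ) = V.hat x ξ := V.hat_isDouble.R_grade x y ξ hξ

theorem dproj_tmul {V W : DObj c k} {y z : X} {ξ : V.carrier} {η : W.carrier}
    (hξ : V.dproj y ξ = ξ) (hη : W.dproj z η = η) :
    (tensor V W).dproj (c.circ y z) (ξ ⊗ₜ η : V.carrier ⊗[k] W.carrier) = ξ ⊗ₜ η := by
  refine (tensorProj_tmul _ V.isDObj.grading W.isDObj.grading hξ hη _).trans ?_
  rw [if_pos (c.bideg_circ y z).symm]

theorem hat_tmul {V W : DObj c k} {y z : X} {ξ : V.carrier} {η : W.carrier}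
    (hξ : V.dproj y ξ = ξ) (hη : W.dproj z η = η) (x : X) :
    (tensor V W).hat x (ξ ⊗ₜ η : V.carrier ⊗[k] W.carrier) =
      (V.hat (c.laD z x) ξ ⊗ₜ W.hat x η : V.carrier ⊗[k] W.carrier) := by
  rw [tensor_hat]
  refine (tensorHat_tmul V W hξ hη x).trans ?_
  rw [dnorm_bideg]

theorem proj_comm {A B : DObj c k} {f : A.carrier →ₗ[k] B.carrier} {n : X} {α : A.carrier}
    (h1 : A.dproj n α = α) (h2 : B.dproj n (f α) = f α) (i : c.Bideg) :
    f (A.proj i α) = B.proj i (f α) := by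
  rw [proj_of_homog A.isDObj.grading h1, proj_of_homog B.isDObj.grading h2, apply_ite f, map_zero]

theorem dproj_unit (r : k) : (unit c k).dproj 1 r = r := by
  have hb : c.bideg 1 = (1, 1) := by
    have := c.parts_unique (x := (1 : X)) (u := 1) (s := 1) (by simp)
    simp [bideg, this]
  simp only [dproj, hb, if_true]; rfl

theorem hat_unit (x : X) (r : k) : (unit c k).hat x r = r := by
  rw [hat, hatAct_eq (unit c k).isDObj (a := 1) (w := 1) x (by simp only [if_true]; rfl)]; rfl

/-! #### Associator -/

/-- `ξ ⊗ (η ⊗ ζ) ↦ ξ ◁̄ τ(⟨η⟩,⟨ζ⟩)^ε ⊗ (η ⊗ ζ)`, where `t` is the power map `g ↦ g ^ ε`. -/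
def twist (U V W : DObj c k) (t : c.G → c.G) :
    Module.End k (U.carrier ⊗[k] (V.carrier ⊗[k] W.carrier)) :=
  ∑ j, ∑ l, TensorProduct.map (U.ract (t (c.tau j.1 l.1)))
    (TensorProduct.map (V.proj j) (W.proj l))

theorem twist_tmul {U V W : DObj c k} (t : c.G → c.G) (ξ : U.carrier) {y z : X} {η : V.carrier}
    {ζ : W.carrier} (hη : V.dproj y η = η) (hζ : W.dproj z ζ = ζ) :
    twist U V W t (ξ ⊗ₜ (η ⊗ₜ ζ)) = U.hat (t (c.tauD y z)) ξ ⊗ₜ (η ⊗ₜ ζ) := by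
  simp only [twist, LinearMap.sum_apply, TensorProduct.map_tmul,
    proj_of_homog V.isDObj.grading hη, proj_of_homog W.isDObj.grading hζ]
  rw [Finset.sum_eq_single (c.bideg y), Finset.sum_eq_single (c.bideg z)] <;>
    simp +contextual [ract_eq, tauD, bideg]

/-- `Φ((ξ ⊗ η) ⊗ ζ) = ξ ◁̄ τ(⟨η⟩,⟨ζ⟩) ⊗ (η ⊗ ζ)` -/
def assocLin (U V W : DObj c k) : (U.carrier ⊗[k] V.carrier) ⊗[k] W.carrier →ₗ[k]
    U.carrier ⊗[k] (V.carrier ⊗[k] W.carrier) :=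
  twist U V W id ∘ₗ (TensorProduct.assoc k U.carrier V.carrier W.carrier).toLinearMap

/-- `Φ⁻¹(ξ ⊗ (η ⊗ ζ)) = (ξ ◁̄ τ(⟨η⟩,⟨ζ⟩)⁻¹ ⊗ η) ⊗ ζ` -/
def assocInvLin (U V W : DObj c k) : U.carrier ⊗[k] (V.carrier ⊗[k] W.carrier) →ₗ[k]
    (U.carrier ⊗[k] V.carrier) ⊗[k] W.carrier :=
  (TensorProduct.assoc k U.carrier V.carrier W.carrier).symm.toLinearMap ∘ₗ twist U V W (·⁻¹)

theorem assocLin_tmul {U V W : DObj c k} (ξ : U.carrier) {y z : X} {η : V.carrier}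
    {ζ : W.carrier} (hη : V.dproj y η = η) (hζ : W.dproj z ζ = ζ) :
    assocLin U V W ((ξ ⊗ₜ η) ⊗ₜ ζ) = U.hat (c.tauD y z) ξ ⊗ₜ (η ⊗ₜ ζ) :=
  twist_tmul id ξ hη hζ

theorem assocInvLin_tmul {U V W : DObj c k} (ξ : U.carrier) {y z : X} {η : V.carrier}
    {ζ : W.carrier} (hη : V.dproj y η = η) (hζ : W.dproj z ζ = ζ) :
    assocInvLin U V W (ξ ⊗ₜ (η ⊗ₜ ζ)) = (U.hat (c.tauD y z : X)⁻¹ ξ ⊗ₜ η) ⊗ₜ ζ := by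
  rw [assocInvLin, LinearMap.comp_apply, twist_tmul (·⁻¹) ξ hη hζ]; rfl

/-- The associator as an invertible linear map. -/
def assocEquiv (U V W : DObj c k) : (U.carrier ⊗[k] V.carrier) ⊗[k] W.carrier ≃ₗ[k]
    U.carrier ⊗[k] (V.carrier ⊗[k] W.carrier) :=
  LinearEquiv.ofLinearMap (assocLin U V W) (assocInvLin U V W)
    (ext_homog₃' fun x ξ y η z ζ hξ hη hζ => by
      rw [LinearMap.comp_apply, assocInvLin_tmul _ hη hζ, assocLin_tmul _ hη hζ, ← hat_mul,
        inv_mul_cancel, hat_one]; rfl)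
    (ext_homog₃ fun x ξ y η z ζ hξ hη hζ => by
      rw [LinearMap.comp_apply, assocLin_tmul _ hη hζ, assocInvLin_tmul _ hη hζ, ← hat_mul,
        mul_inv_cancel, hat_one]; rfl)

/-- The associator `Φ`. -/
def associator (U V W : DObj c k) : tensor (tensor U V) W ≅ tensor U (tensor V W) :=
  isoMk (V := tensor (tensor U V) W) (W := tensor U (tensor V W)) (assocEquiv U V W)
    (fun i => ext_homog₃ fun x ξ y η z ζ hξ hη hζ => by
      refine proj_comm (f := (assocEquiv U V W).toLinearMap) (A := tensor (tensor U V) W) (B := tensor U (tensor V W))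
        (dproj_tmul (V := tensor U V) (dproj_tmul hξ hη) hζ) ?_ i
      refine (congrArg _ (assocLin_tmul ξ hη hζ)).trans
        (Eq.trans ?_ (assocLin_tmul ξ hη hζ).symm)
      rw [circ_circ]
      exact dproj_tmul (W := tensor V W) (dproj_hat U hξ _) (dproj_tmul hη hζ))
    (fun x => ext_homog₃ fun a ξ y η z ζ hξ hη hζ => by
      refine (congrArg (assocLin U V W) (hat_tmul (V := tensor U V) (dproj_tmul hξ hη) hζ x)).trans
        (Eq.trans ?_ (congrArg ((tensor U (tensor V W)).hat x) (assocLin_tmul ξ hη hζ)).symm)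
      rw [hat_tmul hξ hη, assocLin_tmul _ (dproj_hat V hη _) (dproj_hat W hζ _)]
      refine Eq.trans ?_ (hat_tmul (V := U) (W := tensor V W) (dproj_hat U hξ _)
        (dproj_tmul hη hζ) x).symm
      rw [hat_tmul hη hζ, ← hat_mul, ← hat_mul, laD_circ])

theorem tmul_map {V V' W W' : DObj c k} (f : V ⟶ V') (g : W ⟶ W') (ξ : V.carrier)
    (η : W.carrier) : TensorProduct.map (Hom.lin f) (Hom.lin g) (ξ ⊗ₜ η) =
      Hom.lin f ξ ⊗ₜ Hom.lin g η := rfl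

/-- The tensor product of morphisms. -/
def tensorMap {V V' W W' : DObj c k} (f : V ⟶ V') (g : W ⟶ W') : tensor V W ⟶ tensor V' W' :=
  homMk (V := tensor V W) (W := tensor V' W') (TensorProduct.map (Hom.lin f) (Hom.lin g))
    (fun i => ext_homog₂ fun y ξ z η hξ hη => by
      refine proj_comm (f := TensorProduct.map (Hom.lin f) (Hom.lin g)) (A := tensor V W) (B := tensor V' W') (dproj_tmul hξ hη) ?_ i
      exact dproj_tmul (Hom.map_homog f hξ) (Hom.map_homog g hη))
    (fun x => ext_homog₂ fun y ξ z η hξ hη => by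
      refine (congrArg _ (hat_tmul hξ hη x)).trans ?_
      refine Eq.trans ?_ (hat_tmul (Hom.map_homog f hξ) (Hom.map_homog g hη) x).symm
      rw [← Hom.map_hat, ← Hom.map_hat]; rfl)

/-- The left unit isomorphism `k ⊗ V ≅ V`, `1 ⊗ ξ ↦ ξ`. -/
def leftUnitor (V : DObj c k) : tensor (unit c k) V ≅ V :=
  isoMk (V := tensor (unit c k) V) (TensorProduct.lid k V.carrier)
    (fun i => ext_homog₂ (V := unit c k) fun y r z η hr hη => by
      refine proj_comm (f := (TensorProduct.lid k V.carrier).toLinearMap) (A := tensor (unit c k) V) (n := z) ?_ ?_ i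
      · have := dproj_tmul (V := unit c k) (dproj_unit r) hη
        rwa [one_circ] at this
      · change V.dproj z (r • η) = r • η
        rw [map_smul, hη])
    (fun x => ext_homog₂ (V := unit c k) fun y r z η hr hη => by
      refine (congrArg (TensorProduct.lid k V.carrier)
        (hat_tmul (V := unit c k) (dproj_unit r) hη x)).trans ?_
      rw [hat_unit]
      change r • V.hat x η = V.hat x (r • η)
      rw [map_smul])

/-- The right unit isomorphism `V ⊗ k ≅ V`, `ξ ⊗ 1 ↦ ξ`. -/
def rightUnitor (V : DObj c k) : tensor V (unit c k) ≅ V :=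
  isoMk (V := tensor V (unit c k)) (TensorProduct.rid k V.carrier)
    (fun i => ext_homog₂ (W := unit c k) fun y η z r hη hr => by
      refine proj_comm (f := (TensorProduct.rid k V.carrier).toLinearMap) (A := tensor V (unit c k)) (n := y) ?_ ?_ i
      · have := dproj_tmul (W := unit c k) hη (dproj_unit r)
        rwa [circ_one] at this
      · change V.dproj y (r • η) = r • η
        rw [map_smul, hη])
    (fun x => ext_homog₂ (W := unit c k) fun y η z r hη hr => by
      refine (congrArg (TensorProduct.rid k V.carrier)
        (hat_tmul (W := unit c k) hη (dproj_unit r) x)).trans ?_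
      rw [hat_unit]
      have : c.laD 1 x = x := by simp [laD, raD, mPart_one]
      rw [this]
      change r • V.hat x η = V.hat x (r • η)
      rw [map_smul])

instance : MonoidalCategoryStruct (DObj c k) where
  tensorObj := tensor
  tensorUnit := unit c k
  whiskerLeft V _ _ f := tensorMap (𝟙 V) f
  whiskerRight f V := tensorMap f (𝟙 V)
  tensorHom f g := tensorMap f g
  associator := associator
  leftUnitor := leftUnitor
  rightUnitor := rightUnitor

instance : MonoidalCategory (DObj c k) := MonoidalCategory.ofTensorHom
  (id_tensorHom_id := fun V W => hom_ext (TensorProduct.map_id))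
  (id_tensorHom := fun V _ _ f => rfl)
  (tensorHom_id := fun f V => rfl)
  (tensorHom_comp_tensorHom := fun f₁ f₂ g₁ g₂ =>
    hom_ext (TensorProduct.map_comp _ _ _ _).symm)
  (associator_naturality := fun {U V W U' V' W'} f g h =>
    hom_ext (ext_homog₃ (U := U) (V := V) (W := W) fun x ξ y η z ζ hξ hη hζ => by
      change assocLin U' V' W' ((Hom.lin f ξ ⊗ₜ Hom.lin g η) ⊗ₜ Hom.lin h ζ) =
        TensorProduct.map (Hom.lin f) (TensorProduct.map (Hom.lin g) (Hom.lin h))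
          (assocLin U V W ((ξ ⊗ₜ η) ⊗ₜ ζ))
      rw [assocLin_tmul _ hη hζ, assocLin_tmul _ (Hom.map_homog g hη) (Hom.map_homog h hζ),
        ← Hom.map_hat]; rfl))
  (leftUnitor_naturality := fun {V W} f =>
    hom_ext (ext_homog₂ (V := unit c k) (W := V) fun y r z η hr hη => by
      change r • Hom.lin f η = Hom.lin f (r • η)
      rw [map_smul]))
  (rightUnitor_naturality := fun {V W} f =>
    hom_ext (ext_homog₂ (V := V) (W := unit c k) fun y η z r hη hr => by
      change r • Hom.lin f η = Hom.lin f (r • η)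
      rw [map_smul]))
  (pentagon := fun U V W Z => hom_ext (TensorProduct.ext
    (ext_homog₃ (U := U) (V := V) (W := W) fun x ξ y η z ζ hξ hη hζ =>
      ext_homog (V := Z) fun t ν hν => by
        change TensorProduct.map LinearMap.id (assocLin V W Z) (assocLin U (tensor V W) Z
          (TensorProduct.map (assocLin U V W) LinearMap.id (((ξ ⊗ₜ η) ⊗ₜ ζ) ⊗ₜ ν))) =
          assocLin U V (tensor W Z) (assocLin (tensor U V) W Z (((ξ ⊗ₜ η) ⊗ₜ ζ) ⊗ₜ ν))
        rw [TensorProduct.map_tmul, assocLin_tmul ξ hη hζ, LinearMap.id_apply,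
          assocLin_tmul (V := tensor V W) _ (dproj_tmul hη hζ) hν,
          assocLin_tmul (U := tensor U V) _ hζ hν, hat_tmul hξ hη,
          assocLin_tmul (W := tensor W Z) _ (dproj_hat V hη _) (dproj_tmul hζ hν),
          TensorProduct.map_tmul, LinearMap.id_apply, assocLin_tmul _ hζ hν, ← hat_mul, ← hat_mul]
        congr 3
        have e := c.mPart_raD y (c.tauD z t)
        simp only [ra, coe_tauD, mPart_mul_mul] at e
        simp only [coe_tauD, (c.parts_circ _ _).2, laD, mPart_mul_mul, e]
        group)))
  (triangle := fun V W => hom_ext (ext_homog₃ (U := V) (V := unit c k) (W := W)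
    fun x ξ y r z ζ hξ hr hζ => by
      change TensorProduct.map LinearMap.id (TensorProduct.lid k W.carrier).toLinearMap
        (assocLin V (unit c k) W ((ξ ⊗ₜ r) ⊗ₜ ζ)) =
        TensorProduct.map (TensorProduct.rid k V.carrier).toLinearMap LinearMap.id ((ξ ⊗ₜ r) ⊗ₜ ζ)
      rw [assocLin_tmul (V := unit c k) _ (dproj_unit r) hζ, tauD_one_left]
      change V.hat 1 ξ ⊗ₜ (r • ζ) = (r • ξ) ⊗ₜ[k] ζ
      rw [hat_one, TensorProduct.smul_tmul]))

/-! #### Braiding -/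

/-- `Ψ(ξ ⊗ η) = ⟨ξ⟩ ▷̄ η ⊗ ξ ◁̄ |η|` -/
def braidLin (V W : DObj c k) : V.carrier ⊗[k] W.carrier →ₗ[k] W.carrier ⊗[k] V.carrier :=
  gradedLift V.proj W.proj fun i j => TensorProduct.map (W.lact i.1) (V.ract j.2) ∘ₗ
    (TensorProduct.comm k V.carrier W.carrier).toLinearMap

/-- `Ψ⁻¹(ξ' ⊗ η') = η' ◁̂ |ξ' ◁̂ ⟨η'⟩|⁻¹ ⊗ ξ' ◁̂ ⟨η'⟩` -/
def braidInvLin (V W : DObj c k) : W.carrier ⊗[k] V.carrier →ₗ[k] V.carrier ⊗[k] W.carrier :=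
  gradedLift W.proj V.proj fun i j =>
    TensorProduct.map (V.hat (c.gPart (raD (c.dnorm i) j.1))) (W.hat j.1) ∘ₗ
      (TensorProduct.comm k W.carrier V.carrier).toLinearMap

theorem braidLin_tmul {V W : DObj c k} {y z : X} {ξ : V.carrier} {η : W.carrier}
    (hξ : V.dproj y ξ = ξ) (hη : W.dproj z η = η) :
    braidLin V W (ξ ⊗ₜ η) =
      W.hat (c.mPart (raD y (c.gPart z : X)⁻¹) : X)⁻¹ η ⊗ₜ V.hat (c.gPart z : X)⁻¹ ξ := by
  have h : c.mPart (raD y (c.gPart z : X)⁻¹) = c.ra (c.mPart y) (c.gPart z)⁻¹ := by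
    rw [← mPart_raD, Subgroup.coe_inv]
  rw [braidLin, gradedLift_tmul V.isDObj.grading W.isDObj.grading _ hξ hη, h]
  simp only [LinearMap.comp_apply, LinearEquiv.coe_coe, TensorProduct.comm_tmul,
    TensorProduct.map_tmul, bideg, ract_eq, Subgroup.coe_inv]
  rw [lact_eq W _ hη]; rfl

theorem braidInvLin_tmul {V W : DObj c k} {y z : X} {ξ : W.carrier} {η : V.carrier}
    (hξ : W.dproj y ξ = ξ) (hη : V.dproj z η = η) :
    braidInvLin V W (ξ ⊗ₜ η) =
      V.hat (c.gPart (raD y (c.mPart z))) η ⊗ₜ W.hat (c.mPart z) ξ := by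
  rw [braidInvLin, gradedLift_tmul W.isDObj.grading V.isDObj.grading _ hξ hη]
  simp only [LinearMap.comp_apply, LinearEquiv.coe_coe, TensorProduct.comm_tmul,
    TensorProduct.map_tmul, dnorm_bideg]
  rfl

/-- The braiding as an invertible linear map. -/
def braidEquiv (V W : DObj c k) : V.carrier ⊗[k] W.carrier ≃ₗ[k] W.carrier ⊗[k] V.carrier :=
  LinearEquiv.ofLinearMap (braidLin V W) (braidInvLin V W)
    (ext_homog₂ fun y ξ z η hξ hη => by
      rw [LinearMap.comp_apply, braidInvLin_tmul hξ hη,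
        braidLin_tmul (dproj_hat V hη _) (dproj_hat W hξ _), ← hat_mul, ← hat_mul,
        mul_inv_cancel, hat_one]
      have : raD (raD z (c.gPart (raD y (c.mPart z)))) (c.gPart (raD y (c.mPart z)) : X)⁻¹ = z := by
        simp only [raD]; group
      rw [this, mul_inv_cancel, hat_one]; rfl)
    (ext_homog₂ fun y ξ z η hξ hη => by
      rw [LinearMap.comp_apply, braidLin_tmul hξ hη,
        braidInvLin_tmul (dproj_hat W hη _) (dproj_hat V hξ _), ← hat_mul, ← hat_mul,
        inv_mul_cancel, hat_one]
      generalize (c.mPart (raD y (c.gPart z : X)⁻¹) : X) = q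
      have : raD (raD z q⁻¹) q = z := by simp only [raD]; group
      rw [this, inv_mul_cancel, hat_one]; rfl)

theorem braid_circ (y z : X) : c.circ (raD z (c.mPart (raD y (c.gPart z : X)⁻¹) : X)⁻¹)
    (raD y (c.gPart z : X)⁻¹) = c.circ y z := by
  rw [circ, circ]
  generalize hq : raD y (c.gPart z : X)⁻¹ = q
  have hy : y = raD q (c.gPart z) := by rw [← hq]; simp only [raD]; group
  rw [hy, c.coe_gPart q]
  simp only [raD]; group
  rw [mul_assoc, gPart_mul_mPart]

theorem braid_hat₁ (z x : X) :
    c.laD z x * (c.gPart (raD z x) : X)⁻¹ = (c.gPart z : X)⁻¹ * x := by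
  rw [laD, coe_gPart, coe_gPart]; simp only [raD]; group

theorem braid_hat₂ (y z x : X) :
    x * (c.mPart (raD (raD y (c.laD z x)) (c.gPart (raD z x) : X)⁻¹) : X)⁻¹ =
      (c.mPart (raD y (c.gPart z : X)⁻¹) : X)⁻¹ * c.laD (raD y (c.gPart z : X)⁻¹) x := by
  have h1 : ∀ a b : X, raD (raD y a) b = raD y (a * b) := by
    intro a b; simp only [raD]; group
  rw [h1, braid_hat₁, laD, h1]; group

/-- The braiding `Ψ`. -/
def braid (V W : DObj c k) : tensor V W ≅ tensor W V :=
  isoMk (V := tensor V W) (W := tensor W V) (braidEquiv V W)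
    (fun i => ext_homog₂ fun y ξ z η hξ hη => by
      refine proj_comm (f := (braidEquiv V W).toLinearMap) (A := tensor V W) (B := tensor W V)
        (dproj_tmul hξ hη) ?_ i
      refine (congrArg _ (braidLin_tmul hξ hη)).trans (Eq.trans ?_ (braidLin_tmul hξ hη).symm)
      rw [← braid_circ y z]
      exact dproj_tmul (dproj_hat W hη _) (dproj_hat V hξ _))
    (fun x => ext_homog₂ fun y ξ z η hξ hη => by
      refine (congrArg (braidLin V W) (hat_tmul hξ hη x)).trans
        (Eq.trans ?_ (congrArg ((tensor W V).hat x) (braidLin_tmul hξ hη)).symm)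
      rw [braidLin_tmul (dproj_hat V hξ _) (dproj_hat W hη _),
        hat_tmul (dproj_hat W hη _) (dproj_hat V hξ _), ← hat_mul, ← hat_mul, ← hat_mul, ← hat_mul,
        braid_hat₁, braid_hat₂])

theorem raD_raD (y a b : X) : raD (raD y a) b = raD y (a * b) := by
  simp only [raD]; group

theorem hexagon₂ (y z : X) : (c.tauD y z : X) * (c.gPart (c.circ y z) : X)⁻¹ =
    (c.gPart y : X)⁻¹ * (c.gPart z : X)⁻¹ := by
  rw [(c.parts_circ y z).1]; simp only [Subgroup.coe_mul]; group

theorem mPart_braid (q z : X) :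
    c.mPart (c.mPart (raD z (c.mPart (raD q (c.gPart z : X)⁻¹) : X)⁻¹) *
      (c.mPart (raD q (c.gPart z : X)⁻¹) : X)) = c.mPart (c.mPart q * c.mPart z) := by
  have h : c.mPart (raD q (c.gPart z : X)⁻¹) = c.ra (c.mPart q) (c.gPart z)⁻¹ := by
    rw [← mPart_raD, Subgroup.coe_inv]
  rw [mPart_mul_mul, h]
  nth_rewrite 1 [← c.gPart_mul_mPart z]
  simp only [raD, inv_inv, mul_assoc, inv_mul_cancel, mul_one]
  rw [ra, mPart_mul_mul, Subgroup.coe_inv]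
  congr 1; group

theorem hexagon₁ (x y z : X) :
    c.laD z (c.mPart (raD x ((c.gPart y : X)⁻¹ * (c.gPart z : X)⁻¹)) : X)⁻¹ *
      c.tauD (raD z (c.mPart (raD x ((c.gPart y : X)⁻¹ * (c.gPart z : X)⁻¹)) : X)⁻¹)
        (raD x ((c.gPart y : X)⁻¹ * (c.gPart z : X)⁻¹)) =
    (c.mPart (raD x (c.gPart y : X)⁻¹) : X)⁻¹ * c.tauD (raD x (c.gPart y : X)⁻¹) z := by
  rw [← raD_raD x]
  generalize raD x (c.gPart y : X)⁻¹ = q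
  rw [coe_tauD, coe_tauD, laD]
  rw [mPart_braid]; group

theorem hexagon₃ (y z : X) : (c.tauD (raD z (c.mPart (raD y (c.gPart z : X)⁻¹) : X)⁻¹)
      (raD y (c.gPart z : X)⁻¹) : X)⁻¹ *
      (c.gPart (raD z (c.mPart (raD y (c.gPart z : X)⁻¹) : X)⁻¹) : X)⁻¹ =
    (c.tauD y z : X)⁻¹ * c.laD y (c.gPart z : X)⁻¹ := by
  rw [coe_tauD, mPart_braid, coe_tauD, laD,
    c.coe_gPart (raD z (c.mPart (raD y (c.gPart z : X)⁻¹) : X)⁻¹)]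
  have hz : (c.mPart z : X)⁻¹ * (c.gPart z : X)⁻¹ = z⁻¹ := by
    rw [← mul_inv_rev, gPart_mul_mPart]
  generalize (c.mPart (raD y (c.gPart z : X)⁻¹) : X) = r
  generalize (c.mPart (raD z r⁻¹) : X) = p
  calc _ = (c.mPart (c.mPart y * c.mPart z : X) : X) * z⁻¹ * r⁻¹ := by simp only [raD]; group
    _ = _ := by rw [← hz]; group

theorem hexagon₄ (p q : X) : (c.mPart (c.circ p q) : X)⁻¹ * (c.tauD p q : X)⁻¹ =
    (c.mPart q : X)⁻¹ * (c.mPart p : X)⁻¹ := by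
  rw [(c.parts_circ p q).2, coe_tauD]; group

instance : BraidedCategory (DObj c k) where
  braiding := braid
  braiding_naturality_right V W W' f := hom_ext (ext_homog₂ (V := V) (W := W)
    fun y ξ z η hξ hη => by
      change braidLin V W' (ξ ⊗ₜ Hom.lin f η) =
        TensorProduct.map (Hom.lin f) LinearMap.id (braidLin V W (ξ ⊗ₜ η))
      rw [braidLin_tmul hξ hη, braidLin_tmul hξ (Hom.map_homog f hη), ← Hom.map_hat]; rfl)
  braiding_naturality_left {V V'} f W := hom_ext (ext_homog₂ (V := V) (W := W)
    fun y ξ z η hξ hη => by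
      change braidLin V' W (Hom.lin f ξ ⊗ₜ η) =
        TensorProduct.map LinearMap.id (Hom.lin f) (braidLin V W (ξ ⊗ₜ η))
      rw [braidLin_tmul hξ hη, braidLin_tmul (Hom.map_homog f hξ) hη, ← Hom.map_hat]; rfl)
  hexagon_forward U V W := hom_ext (ext_homog₃ (U := U) (V := V) (W := W)
    fun x ξ y η z ζ hξ hη hζ => by
      change assocLin V W U (braidLin U (tensor V W) (assocLin U V W ((ξ ⊗ₜ η) ⊗ₜ ζ))) =
        TensorProduct.map LinearMap.id (braidLin U W) (assocLin V U W
          (TensorProduct.map (braidLin U V) LinearMap.id ((ξ ⊗ₜ η) ⊗ₜ ζ)))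
      rw [assocLin_tmul _ hη hζ, braidLin_tmul (dproj_hat U hξ _) (dproj_tmul hη hζ), ← hat_mul,
        raD_raD, hexagon₂, hat_tmul hη hζ, assocLin_tmul _ (dproj_hat W hζ _) (dproj_hat U hξ _),
        TensorProduct.map_tmul, braidLin_tmul hξ hη, LinearMap.id_apply,
        assocLin_tmul _ (dproj_hat U hξ _) hζ, TensorProduct.map_tmul,
        braidLin_tmul (dproj_hat U hξ _) hζ, LinearMap.id_apply, ← hat_mul, ← hat_mul, ← hat_mul,
        raD_raD, hexagon₁])
  hexagon_reverse U V W := hom_ext (ext_homog₃' (U := U) (V := V) (W := W)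
    fun x ξ y η z ζ hξ hη hζ => by
      change assocInvLin W U V (braidLin (tensor U V) W (assocInvLin U V W (ξ ⊗ₜ (η ⊗ₜ ζ)))) =
        TensorProduct.map (braidLin U W) LinearMap.id (assocInvLin U W V
          (TensorProduct.map LinearMap.id (braidLin V W) (ξ ⊗ₜ (η ⊗ₜ ζ))))
      rw [assocInvLin_tmul _ hη hζ, braidLin_tmul (dproj_tmul (dproj_hat U hξ _) hη) hζ,
        hat_tmul (dproj_hat U hξ _) hη, assocInvLin_tmul _ (dproj_hat U (dproj_hat U hξ _) _)
          (dproj_hat V hη _), TensorProduct.map_tmul, braidLin_tmul hη hζ, LinearMap.id_apply,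
        assocInvLin_tmul _ (dproj_hat W hζ _) (dproj_hat V hη _), TensorProduct.map_tmul,
        braidLin_tmul (dproj_hat U hξ _) (dproj_hat W hζ _)]
      simp only [← hat_mul, raD_raD, LinearMap.id_apply]
      rw [hexagon₃, raD_circ, raD_raD, hexagon₄])

/-! ### The object `D` -/

theorem _root_.CosetReps.existsUnique_circ (h : c.LeftDivision) (y t : X) :
    ∃! a : X, c.circ y a = t := by
  obtain ⟨p, hp, hu⟩ := h (c.mPart y) (c.mPart t)
  have hp' := congrArg (Subtype.val) hp
  refine ⟨((c.gPart t * (c.tau (c.mPart y) p)⁻¹ * (c.gPart y)⁻¹ : c.G) : X) * p, ?_, ?_⟩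
  · have := c.parts_unique rfl
      (u := c.gPart t * (c.tau (c.mPart y) p)⁻¹ * (c.gPart y)⁻¹) (s := p)
    simp only [circ, this]
    have e1 : (c.dot (c.mPart y) p : X) = (c.tau (c.mPart y) p : X)⁻¹ * (c.mPart y * p) := by
      rw [tau, coe_gPart, dot]; group
    have e2 : y = c.gPart y * c.mPart y := (c.gPart_mul_mPart y).symm
    calc _ = (c.gPart t : X) * ((c.tau (c.mPart y) p : X)⁻¹ * ((c.gPart y : X)⁻¹ * y * p)) := by
          simp only [Subgroup.coe_mul, Subgroup.coe_inv]; group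
      _ = (c.gPart t : X) * c.dot (c.mPart y) p := by
          rw [e1]; congr 3; nth_rewrite 2 [e2]; group
      _ = t := by rw [hp', gPart_mul_mPart]
  · intro a ha
    have h1 := c.parts_circ y a
    rw [ha] at h1
    have hm : c.mPart a = p := hu _ h1.2.symm
    have hg : c.gPart a = c.gPart t * (c.tau (c.mPart y) p)⁻¹ * (c.gPart y)⁻¹ := by
      rw [h1.1, tauD, hm]; group
    rw [← hg, ← hm, gPart_mul_mPart]

/-- `‖δ_y ⊗ x‖`, the unique solution `a` of `y ∘ a = y ◁̃ x`. -/
def _root_.CosetReps.basisDeg (h : c.LeftDivision) (y x : X) : X :=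
  (c.existsUnique_circ h y (raD y x)).choose

theorem _root_.CosetReps.circ_basisDeg (h : c.LeftDivision) (y x : X) :
    c.circ y (c.basisDeg h y x) = raD y x :=
  (c.existsUnique_circ h y (raD y x)).choose_spec.1

theorem _root_.CosetReps.eq_basisDeg (h : c.LeftDivision) {y x a : X}
    (ha : c.circ y a = raD y x) : a = c.basisDeg h y x :=
  (c.existsUnique_circ h y (raD y x)).choose_spec.2 a ha

/-- The action of `z ∈ X` on basis elements, indexed by pairs `(y, x)`:
`(δ_y ⊗ x) ◁̂ z = δ_{y ◁̃ (a ▷̃ z)} ⊗ (a ▷̃ z)⁻¹ x z` with `a = ‖δ_y ⊗ x‖`. -/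
def _root_.CosetReps.basisHat (h : c.LeftDivision) (z : X) (p : X × X) : X × X :=
  let a := c.basisDeg h p.1 p.2
  (raD p.1 (c.laD a z), (c.laD a z)⁻¹ * p.2 * z)

theorem _root_.CosetReps.basisDeg_basisHat (h : c.LeftDivision) (z : X) (p : X × X) :
    c.basisDeg h (c.basisHat h z p).1 (c.basisHat h z p).2 = raD (c.basisDeg h p.1 p.2) z := by
  refine (c.eq_basisDeg h ?_).symm
  simp only [basisHat]
  rw [← raD_circ, circ_basisDeg, raD_raD, raD_raD]
  congr 1; group

/-- The projections to the homogeneous components of `D`. -/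
def dblProj (k : Type u) [Field k] (h : c.LeftDivision) (i : c.Bideg) :
    Module.End k (X × X →₀ k) :=
  Finsupp.linearCombination k fun p =>
    if c.bideg (c.basisDeg h p.1 p.2) = i then Finsupp.single p 1 else 0

/-- The action of `X` on `D`. -/
def dblHat (k : Type u) [Field k] (h : c.LeftDivision) (z : X) : Module.End k (X × X →₀ k) :=
  Finsupp.lmapDomain k k (c.basisHat h z)

/-- The action of `M` on `D`: `s ▷̄ η = η ◁̂ (s ◁ |η|)⁻¹`. -/
def dblLact (k : Type u) [Field k] (h : c.LeftDivision) (s : c.M) : Module.End k (X × X →₀ k) :=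
  Finsupp.linearCombination k fun p =>
    dblHat k h (c.ra s (c.bideg (c.basisDeg h p.1 p.2)).2 : X)⁻¹ (Finsupp.single p 1)

theorem dblProj_single (h : c.LeftDivision) (i : c.Bideg) (p : X × X) :
    dblProj k h i (Finsupp.single p 1) =
      if c.bideg (c.basisDeg h p.1 p.2) = i then Finsupp.single p 1 else 0 := by
  simp [dblProj]

theorem dblHat_single (h : c.LeftDivision) (z : X) (p : X × X) :
    dblHat k h z (Finsupp.single p 1) = Finsupp.single (c.basisHat h z p) 1 := by
  simp [dblHat]

theorem dbl_ext {Z : Type*} [AddCommGroup Z] [Module k Z] {f g : (X × X →₀ k) →ₗ[k] Z}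
    (h : ∀ p, f (Finsupp.single p 1) = g (Finsupp.single p 1)) : f = g :=
  Finsupp.lhom_ext' fun p => LinearMap.ext_ring (h p)

variable (k) in
/-- The object `D` of `𝒟`, with basis `δ_y ⊗ x = Finsupp.single (y, x) 1`. -/
def dbl (h : c.LeftDivision) : DObj c k where
  carrier := X × X →₀ k
  proj := dblProj k h
  ract u := dblHat k h u
  lact := dblLact k h
  isDObj := by
    refine IsDouble.isDObj (R := dblHat k h) ⟨fun ξ => ?_, fun x y ξ => ?_, fun x y ξ hξ => ?_⟩
      ?_ (fun _ => rfl) (fun a w s ξ hξ => ?_)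
    · suffices dblHat k h 1 = LinearMap.id from LinearMap.congr_fun this ξ
      refine dbl_ext fun p => ?_
      have : c.basisHat h 1 p = p := by simp [basisHat, laD, raD]
      rw [dblHat_single, this]; rfl
    · suffices dblHat k h (x * y) = dblHat k h y ∘ₗ dblHat k h x from LinearMap.congr_fun this ξ
      refine dbl_ext fun p => ?_
      rw [LinearMap.comp_apply, dblHat_single, dblHat_single, dblHat_single]
      congr 1
      conv_rhs => rw [basisHat, basisDeg_basisHat]
      simp only [basisHat, laD_mul]
      refine Prod.ext ?_ ?_
      · exact (raD_raD _ _ _).symm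
      · dsimp only; group
    · suffices dblProj k h (c.bideg (raD y x)) ∘ₗ dblHat k h x ∘ₗ dblProj k h (c.bideg y) =
          dblHat k h x ∘ₗ dblProj k h (c.bideg y) by
        have := LinearMap.congr_fun this ξ
        simpa only [LinearMap.comp_apply, hξ] using this
      refine dbl_ext fun p => ?_
      simp only [LinearMap.comp_apply, dblProj_single]
      split_ifs with hp
      · rw [dblHat_single, dblProj_single, basisDeg_basisHat, if_pos]
        rw [← c.dnorm_bideg y, ← hp, dnorm_bideg]
      · simp
    · rw [CompleteOrthogonalIdempotents.iff_ortho_complete]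
      constructor
      · intro i j hij
        refine dbl_ext fun p => ?_
        rw [Module.End.mul_apply, dblProj_single]
        split_ifs with hp
        · rw [dblProj_single, if_neg (by rintro rfl; exact hij hp)]; rfl
        · rw [map_zero]; rfl
      · refine dbl_ext fun p => ?_
        rw [LinearMap.sum_apply]
        simp [dblProj_single]
    · suffices dblLact k h s ∘ₗ dblProj k h (a, w) =
          dblHat k h (c.ra s w : X)⁻¹ ∘ₗ dblProj k h (a, w) by
        have := LinearMap.congr_fun this ξ
        simpa only [LinearMap.comp_apply, hξ] using this
      refine dbl_ext fun p => ?_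
      simp only [LinearMap.comp_apply, dblProj_single]
      split_ifs with hp
      · simp [dblLact, hp]
      · simp

/-- The basis element `δ_y ⊗ x` of `D`. -/
def delta (h : c.LeftDivision) (y x : X) : (dbl k h).carrier :=
  (Finsupp.single (y, x) 1 : X × X →₀ k)

end DObj

end Category

/-! ### The bialgebra structure -/

section Formulas

variable {X : Type u} [Group X] [Fintype X] [DecidableEq X] {c : CosetReps X}
  {k : Type u} [Field k]

open CosetReps DObj

/-- `(δ_y ⊗ x)(δ_w ⊗ z) = δ_{w, y ◁̃ x} δ_{y ◁̃ τ̃(a,b)} ⊗ τ̃(a,b)⁻¹ x z`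
with `a = ‖δ_y ⊗ x‖` and `b = ‖δ_w ⊗ z‖`. -/
def mulFormula (h : c.LeftDivision) (y x w z : X) : (dbl k h).carrier :=
  let a := c.basisDeg h y x
  let b := c.basisDeg h w z
  if w = raD y x then delta h (raD y (c.tauD a b)) ((c.tauD a b : X)⁻¹ * x * z) else 0

/-- `‖h₍₂₎‖ = |h|⁻¹ z⁻¹ |h| x⁻¹ z x` for `h = δ_y ⊗ x`. -/
def deg₂ (h : c.LeftDivision) (y x z : X) : X :=
  let n : X := (c.bideg (c.basisDeg h y x)).2
  n⁻¹ * z⁻¹ * n * x⁻¹ * z * x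

/-- `‖h₍₁₎‖ = |h₍₂₎| ‖h‖ ⟨h₍₂₎⟩⁻¹` for `h = δ_y ⊗ x`. -/
def deg₁ (h : c.LeftDivision) (y x z : X) : X :=
  ((c.bideg (deg₂ h y x z)).2 : X) * c.basisDeg h y x * ((c.bideg (deg₂ h y x z)).1 : X)⁻¹

/-- `Δ(δ_y ⊗ x) = ∑_{zw = y} δ_{w ◁̃ |h||h₍₂₎|⁻¹|h₍₁₎|⁻¹} ⊗ |h₍₁₎||h₍₂₎||h|⁻¹ x ⟨h₍₂₎⟩⁻¹ ⊗
δ_{z ◁̃ |h||h₍₂₎|⁻¹} ⊗ |h₍₂₎||h|⁻¹ x` for `h = δ_y ⊗ x`; here `n`, `n₁`, `n₂` are `|h|`,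
`|h₍₁₎|`, `|h₍₂₎|`, `s₂` is `⟨h₍₂₎⟩` and `p = (z, w)`. -/
def comulFormula (h : c.LeftDivision) (y x : X) : (dbl k h).carrier ⊗[k] (dbl k h).carrier :=
  ∑ p : X × X with p.1 * p.2 = y,
    let n : X := (c.bideg (c.basisDeg h y x)).2
    let n₁ : X := (c.bideg (deg₁ h y x p.1)).2
    let n₂ : X := (c.bideg (deg₂ h y x p.1)).2
    let s₂ : X := (c.bideg (deg₂ h y x p.1)).1
    delta h (raD p.2 (n * n₂⁻¹ * n₁⁻¹)) (n₁ * n₂ * n⁻¹ * x * s₂⁻¹) ⊗ₜ[k]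
      delta h (raD p.1 (n * n₂⁻¹)) (n₂ * n⁻¹ * x)

end Formulas

end

/-! The proof is Tannaka–Krein reconstruction. An object of the category amounts to a space with a
degree ‖ξ‖ in X and a compatible right action ◁̂ of the group X. In this language ‖ξ ⊗ η‖ = ‖ξ‖ ∘
‖η‖, and x acts on ξ ⊗ η as ξ ◁̂ (‖η‖ ▷̃ x) ⊗ η ◁̂ x. The element δ_y ⊗ x of D acts on any object as
"project to degree y, then apply x". The equation y ∘ a = y ◁̃ x for its degree a says exactly that
this action preserves degrees.

The bialgebra axioms relating the product, the unit and the coproduct are deduced from the actions.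
If D acts faithfully, then two morphisms into D, D ⊗ D or D ⊗ (D ⊗ D) agree as soon as they induce
the same maps on all V, V ⊗ W or V ⊗ (W ⊗ Z). Associativity, coassociativity, multiplicativity of Δ
and the unit axioms then reduce to `dblAct_mul`, `dblAct_comul`, `dblAct_one` and naturality of the
action. The counit axioms are short checks on the basis. Uniqueness of product and coproduct is
faithfulness once more.

Faithfulness (`dblAct_faithful`) comes from a regular object with basis e_{p,x}. Acting on the sum
of all e_{p,1} sends δ_y ⊗ x to e_{y,x}, so nothing is lost. With a spectator tensor factor the
associator shifts the labels by a value of τ, and left division recovers that value. The spectator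
is what lets faithfulness pass to tensor products (`ActFaithful.tensor`).

The computation that remains is that the given product and coproduct are morphisms realising
composition of actions and actions on tensor products. The sum over zw = y in Δ appears because p ∘
q = q · (p ◁̃ ⟨q⟩), with ⟨q⟩ the M-part of q: the summand (z, w) sees exactly the ξ ⊗ η with ‖η‖ = z
and ‖ξ‖ ◁̃ ⟨η⟩ = w. -/

noncomputable section

/-! ### Objects acting faithfully in a braided category -/

section Reconstruction

universe v₁ u₁

variable {C : Type u₁} [Category.{v₁} C] [MonoidalCategory C]

/-- The maps `b i : U i ⊗ B ⟶ U i` jointly separate morphisms into `B`, also in the presence of a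
further tensor factor. -/
def ActFaithful {ι : Type*} {U : ι → C} {B : C} (b : ∀ i, U i ⊗ B ⟶ U i) : Prop :=
  ∀ ⦃A E : C⦄ (f g : A ⟶ B ⊗ E),
    (∀ i, U i ◁ f ≫ (α_ _ _ _).inv ≫ b i ▷ E = U i ◁ g ≫ (α_ _ _ _).inv ≫ b i ▷ E) → f = g

/-- The spectator factor is taken to be the unit object. -/
theorem ActFaithful.hom_ext {ι : Type*} {U : ι → C} {B : C} {b : ∀ i, U i ⊗ B ⟶ U i}
    (hb : ActFaithful b) {A : C} {f g : A ⟶ B} (h : ∀ i, U i ◁ f ≫ b i = U i ◁ g ≫ b i) :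
    f = g := by
  have key : ∀ (f : A ⟶ B) i, U i ◁ (f ≫ (ρ_ B).inv) ≫ (α_ _ _ _).inv ≫ b i ▷ (𝟙_ C) =
      (U i ◁ f ≫ b i) ≫ (ρ_ _).inv := by
    intro f i
    rw [whiskerLeft_comp, Category.assoc, whiskerLeft_rightUnitor_inv_assoc, Iso.hom_inv_id_assoc,
      ← rightUnitor_inv_naturality, Category.assoc]
  rw [← cancel_mono (ρ_ B).inv]
  refine hb _ _ fun i => ?_
  rw [key, key, h]

variable [BraidedCategory C]

/-- The action of `B ⊗ B'` on `V ⊗ W` obtained from actions of `B` on `V` and of `B'` on `W`. -/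
def tensorAct {V W B B' : C} (b : V ⊗ B ⟶ V) (b' : W ⊗ B' ⟶ W) :
    (V ⊗ W) ⊗ (B ⊗ B') ⟶ V ⊗ W :=
  tensorμ V W B B' ≫ (b ⊗ₘ b')

/-- Performing the action on W before the one on V exhibits the composite as the action `b` applied
to a morphism `W ⊗ A ⟶ B ⊗ (W ⊗ E)`, the shape in which faithfulness of `b` can be used with
spectator `W ⊗ E`. -/
theorem whiskerLeft_tensorAct {V W B B' A E : C} (b : V ⊗ B ⟶ V) (b' : W ⊗ B' ⟶ W)
    (f : A ⟶ (B ⊗ B') ⊗ E) :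
    (V ⊗ W) ◁ f ≫ (α_ _ _ _).inv ≫ tensorAct b b' ▷ E =
      (α_ V W A).hom ≫
        (V ◁ (W ◁ f ≫ W ◁ (α_ _ _ _).hom ≫ (α_ _ _ _).inv ≫ (β_ W B).hom ▷ (B' ⊗ E) ≫
          (α_ _ _ _).hom ≫ B ◁ ((α_ _ _ _).inv ≫ b' ▷ E)) ≫
        (α_ _ _ _).inv ≫ b ▷ (W ⊗ E)) ≫ (α_ _ _ _).inv := by
  simp only [tensorAct, tensorμ]
  rw [tensorHom_def']
  monoidal

/-- Naturality of the inverse braiding, together with a hexagon, moves `b'` past `B`. So the inner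
morphism of `whiskerLeft_tensorAct` determines the `b'`-action of `f` with its two factors swapped,
and there `B ⊗ E` is the spectator. -/
theorem braided_swap_act {W B B' A E : C} (b' : W ⊗ B' ⟶ W) (f : A ⟶ (B ⊗ B') ⊗ E) :
    W ◁ (f ≫ (β_ B' B).inv ▷ E ≫ (α_ _ _ _).hom) ≫ (α_ _ _ _).inv ≫ b' ▷ (B ⊗ E) =
      (W ◁ f ≫ W ◁ (α_ _ _ _).hom ≫ (α_ _ _ _).inv ≫ (β_ W B).hom ▷ (B' ⊗ E) ≫
          (α_ _ _ _).hom ≫ B ◁ ((α_ _ _ _).inv ≫ b' ▷ E)) ≫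
        (α_ _ _ _).inv ≫ (β_ W B).inv ▷ E ≫ (α_ _ _ _).hom := by
  have h : B ◁ b' ≫ (β_ W B).inv = (β_ (W ⊗ B') B).inv ≫ b' ▷ B := by
    rw [BraidedCategory.braiding_inv_naturality_right]
  rw [BraidedCategory.braiding_tensor_left_inv] at h
  calc _ = W ◁ f ⊗≫ W ◁ (β_ B' B).inv ▷ E ⊗≫ (b' ▷ B) ▷ E ⊗≫ 𝟙 _ := by monoidal
    _ = W ◁ f ⊗≫ ((β_ W B).hom ≫ (β_ W B).inv) ▷ B' ▷ E ⊗≫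
        W ◁ (β_ B' B).inv ▷ E ⊗≫ (b' ▷ B) ▷ E ⊗≫ 𝟙 _ := by
      rw [Iso.hom_inv_id]; monoidal
    _ = W ◁ f ⊗≫ (β_ W B).hom ▷ B' ▷ E ⊗≫ (B ◁ b' ≫ (β_ W B).inv) ▷ E ⊗≫ 𝟙 _ := by
      rw [h]; monoidal
    _ = _ := by monoidal

/-- The two actions are stripped off one after the other: faithfulness of `b` identifies the inner
morphisms, and faithfulness of `b'` then identifies `f` and `g` after the invertible swap of `B` and
`B'`. -/
theorem ActFaithful.tensor {ι ι' : Type*} {U : ι → C} {U' : ι' → C} {B B' : C}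
    {b : ∀ i, U i ⊗ B ⟶ U i} {b' : ∀ i, U' i ⊗ B' ⟶ U' i} (hb : ActFaithful b)
    (hb' : ActFaithful b') :
    ActFaithful (U := fun i : ι × ι' => U i.1 ⊗ U' i.2) fun i => tensorAct (b i.1) (b' i.2) := by
  intro A E f g h
  have h1 : f ≫ (β_ B' B).inv ▷ E ≫ (α_ _ _ _).hom = g ≫ (β_ B' B).inv ▷ E ≫ (α_ _ _ _).hom := by
    refine hb' _ _ fun j => ?_
    rw [braided_swap_act, braided_swap_act]
    congr 1
    refine hb _ _ fun i => ?_
    have := h (i, j)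
    rw [whiskerLeft_tensorAct, whiskerLeft_tensorAct] at this
    simpa only [cancel_epi, cancel_mono] using this
  simpa only [cancel_mono] using h1

variable {D : C} {act : ∀ V : C, V ⊗ D ⟶ V} {mul : D ⊗ D ⟶ D} {comul : D ⟶ D ⊗ D}

/-- Both bracketings act on V as three successive actions of `D`. -/
theorem ActFaithful.mul_assoc (hf : ActFaithful act)
    (hmul : ∀ V, act V ▷ D ≫ act V = (α_ V _ _).hom ≫ V ◁ mul ≫ act V) :
    mul ▷ D ≫ mul = (α_ D D D).hom ≫ D ◁ mul ≫ mul := by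
  have hmul' : ∀ V, V ◁ mul ≫ act V = (α_ V _ _).inv ≫ act V ▷ D ≫ act V := fun V => by
    rw [hmul, Iso.inv_hom_id_assoc]
  refine hf.hom_ext fun V => ?_
  simp only [whiskerLeft_comp, Category.assoc]
  rw [hmul', associator_inv_naturality_middle_assoc, associator_inv_naturality_right_assoc,
    whisker_exchange_assoc, hmul', ← comp_whiskerRight_assoc, hmul']
  monoidal

/-- On V ⊗ (W ⊗ Z) one side induces the action of `D` on V ⊗ (W ⊗ Z), the other the action on (V ⊗
W) ⊗ Z transported along the associator. They agree because the action is natural with respect to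
the associator, which is a morphism of the category. -/
theorem ActFaithful.comul_assoc (hf : ActFaithful act)
    (hnat : ∀ {V W : C} (φ : V ⟶ W), φ ▷ D ≫ act W = act V ≫ φ)
    (hcomul : ∀ V W, act (V ⊗ W) = (V ⊗ W) ◁ comul ≫ tensorμ V W _ _ ≫ (act V ⊗ₘ act W)) :
    comul ≫ D ◁ comul = comul ≫ comul ▷ D ≫ (α_ D D D).hom := by
  refine (hf.tensor (hf.tensor hf)).hom_ext fun ⟨V, W, Z⟩ => ?_
  have h1 : (V ⊗ (W ⊗ Z)) ◁ (comul ≫ D ◁ comul) ≫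
      tensorAct (act V) (tensorAct (act W) (act Z)) = act (V ⊗ (W ⊗ Z)) := by
    rw [hcomul V (W ⊗ Z), hcomul W Z, tensorAct, whiskerLeft_comp, Category.assoc,
      ← id_tensorHom D comul, tensorμ_natural_right_assoc, tensorHom_comp_tensorHom,
      whiskerLeft_id, Category.id_comp, tensorAct]
  have h2 : (V ⊗ (W ⊗ Z)) ◁ (comul ≫ comul ▷ D ≫ (α_ D D D).hom) ≫
      tensorAct (act V) (tensorAct (act W) (act Z)) =
      (α_ V W Z).inv ▷ D ≫ act ((V ⊗ W) ⊗ Z) ≫ (α_ V W Z).hom := by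
    rw [hcomul (V ⊗ W) Z, hcomul V W]
    have e : ((V ⊗ W) ◁ comul ≫ tensorμ V W D D ≫ (act V ⊗ₘ act W) ⊗ₘ act Z) =
        ((V ⊗ W) ◁ comul ⊗ₘ Z ◁ 𝟙 D) ≫ tensorμ V W D D ▷ (Z ⊗ D) ≫
          ((act V ⊗ₘ act W) ⊗ₘ act Z) := by
      rw [← tensorHom_id, tensorHom_comp_tensorHom, tensorHom_comp_tensorHom, whiskerLeft_id,
        Category.id_comp, Category.id_comp]
    rw [e, ← tensorμ_natural_right_assoc]
    simp only [Category.assoc]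
    rw [associator_naturality, associator_monoidal_assoc]
    simp only [tensorAct]
    have e2 : (act V ⊗ₘ (tensorμ W Z D D ≫ (act W ⊗ₘ act Z))) =
      (V ⊗ D) ◁ tensorμ W Z D D ≫ (act V ⊗ₘ (act W ⊗ₘ act Z)) := by simp [← id_tensorHom]
    rw [e2, MonoidalCategory.tensorHom_def (α_ V W Z).hom, tensorHom_id]
    simp only [Category.assoc, whisker_exchange_assoc, inv_hom_whiskerRight_assoc,
      whiskerLeft_comp]
  rw [h1, h2, ← hnat, inv_hom_whiskerRight_assoc]

/-- Both sides act on V ⊗ W as two successive actions of `D`. For the left side this is the module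
axiom on V ⊗ W. -/
theorem ActFaithful.mul_comul (hf : ActFaithful act)
    (hmul : ∀ V, act V ▷ D ≫ act V = (α_ V _ _).hom ≫ V ◁ mul ≫ act V)
    (hcomul : ∀ V W, act (V ⊗ W) = (V ⊗ W) ◁ comul ≫ tensorμ V W _ _ ≫ (act V ⊗ₘ act W)) :
    mul ≫ comul = (comul ⊗ₘ comul) ≫ tensorμ D D D D ≫ (mul ⊗ₘ mul) := by
  refine (hf.tensor hf).hom_ext fun ⟨V, W⟩ => ?_
  have hcomul' : (V ⊗ W) ◁ comul ≫ tensorAct (act V) (act W) = act (V ⊗ W) := (hcomul V W).symm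
  have h1 : (V ⊗ W) ◁ (mul ≫ comul) ≫ tensorAct (act V) (act W) =
      (α_ _ _ _).inv ≫ act (V ⊗ W) ▷ D ≫ act (V ⊗ W) := by
    rw [hmul, Iso.inv_hom_id_assoc, whiskerLeft_comp, Category.assoc, hcomul']
  -- V ⊗ W is a module over the braided tensor product algebra D ⊗ D.
  have h3 : tensorAct (act V) (act W) ▷ (D ⊗ D) ≫ tensorAct (act V) (act W) =
      (α_ _ _ _).hom ≫ (V ⊗ W) ◁ (tensorμ D D D D ≫ (mul ⊗ₘ mul)) ≫
        tensorAct (act V) (act W) := by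
    simp only [tensorAct, comp_whiskerRight, Category.assoc, whiskerLeft_comp]
    rw [tensorμ_natural_left_assoc, tensorHom_comp_tensorHom, hmul, hmul,
      ← tensorHom_comp_tensorHom, tensor_associativity_assoc, ← tensorHom_comp_tensorHom,
      tensorμ_natural_right_assoc]
  rw [h1, whiskerLeft_comp, Category.assoc]
  rw [← cancel_epi (α_ (V ⊗ W) D D).hom, Iso.hom_inv_id_assoc, MonoidalCategory.tensorHom_def]
  rw [whiskerLeft_comp, Category.assoc, ← associator_naturality_middle_assoc,
    ← associator_naturality_right_assoc, ← h3, ← hcomul', comp_whiskerRight_assoc,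
    whisker_exchange_assoc]

theorem ActFaithful.one_comul (hf : ActFaithful act) {one : 𝟙_ C ⟶ D}
    (hone : ∀ V, V ◁ one ≫ act V = (ρ_ V).hom)
    (hcomul : ∀ V W, act (V ⊗ W) = (V ⊗ W) ◁ comul ≫ tensorμ V W _ _ ≫ (act V ⊗ₘ act W)) :
    one ≫ comul = (λ_ _).inv ≫ (one ⊗ₘ one) := by
  refine (hf.tensor hf).hom_ext fun ⟨V, W⟩ => ?_
  simp only [tensorAct, whiskerLeft_comp, Category.assoc]
  rw [← hcomul, hone, tensorμ_natural_right_assoc, tensorHom_comp_tensorHom, hone, hone,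
    tensor_right_unitality]

end Reconstruction

/-! ### Cancellation rules in the double and degrees of basis elements. -/

namespace CosetReps

variable {X : Type u} [Group X] (c : CosetReps X)

theorem circ_left_cancel {r r' s : X} (h : c.circ r s = c.circ r' s) : r = r' := by
  simpa [circ] using h

theorem laD_one_left (x : X) : c.laD 1 x = x := by simp [laD, raD, mPart_one]

theorem raD_one_left (x : X) : raD 1 x = 1 := by simp [raD]

theorem raD_one_right (y : X) : raD y 1 = y := by simp [raD]

theorem raD_injective (x : X) : Function.Injective fun y => raD y x := by
  intro y z h
  simpa [raD] using h

variable [Finite X] {c}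

theorem basisDeg_one_right (h : c.LeftDivision) (y : X) : c.basisDeg h y 1 = 1 :=
  (c.eq_basisDeg h (by rw [circ_one, raD_one_right])).symm

theorem basisDeg_one_left (h : c.LeftDivision) (x : X) : c.basisDeg h 1 x = 1 :=
  (c.eq_basisDeg h (by rw [circ_one, raD_one_left])).symm

theorem basisHat_mul (h : c.LeftDivision) (x y : X) (p : X × X) :
    c.basisHat h (x * y) p = c.basisHat h y (c.basisHat h x p) := by
  conv_rhs => rw [basisHat, basisDeg_basisHat]
  simp only [basisHat, laD_mul]
  refine Prod.ext ?_ ?_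
  · exact (DObj.raD_raD _ _ _).symm
  · dsimp only; group

end CosetReps

/-! ### The basis of D: degree, action of X, linear maps out of D. -/

namespace DObj

open CosetReps

variable {X : Type u} [Group X] [Finite X] {c : CosetReps X} {k : Type u} [Field k]

theorem dproj_of_homog (V : DObj c k) {y : X} {ξ : V.carrier} (hξ : V.dproj y ξ = ξ) (z : X)
    [Decidable (y = z)] : V.dproj z ξ = if y = z then ξ else 0 := by
  rw [dproj, proj_of_homog V.isDObj.grading hξ]
  by_cases h : y = z
  · simp [h]
  · rw [if_neg h, if_neg]
    intro h'
    exact h (by rw [← c.dnorm_bideg y, ← h', dnorm_bideg])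

theorem dproj_delta (h : c.LeftDivision) (y x : X) :
    (dbl k h).dproj (c.basisDeg h y x) (delta h y x) = delta h y x :=
  (dblProj_single h _ _).trans (if_pos rfl)

/-- `hat` is built from the G- and M-actions, so it has to be identified with `basisHat`. Factoring
z⁻¹ into its G- and M-parts, the shift of the M-part by the grade in `hatAct_eq` cancels the
opposite shift in `dblLact`. -/
theorem hat_delta' (h : c.LeftDivision) (z : X) (p : X × X) :
    (dbl k h).hat z (delta h p.1 p.2) =
      delta h (c.basisHat h z p).1 (c.basisHat h z p).2 := by
  have h1 : (dbl k h).proj (c.bideg (c.basisDeg h p.1 p.2)) (delta h p.1 p.2) = delta h p.1 p.2 :=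
    dproj_delta h _ _
  refine (hatAct_eq (dbl k h).isDObj z h1).trans ?_
  change dblHat k h _ (dblLact k h _ (Finsupp.single p 1)) = Finsupp.single (c.basisHat h z p) 1
  rw [dblLact, Finsupp.linearCombination_single, one_smul, dblHat_single, dblHat_single,
    ← basisHat_mul]
  have e : c.ra (c.ra (c.mPart z⁻¹) (c.gPart (c.basisDeg h p.1 p.2))⁻¹⁻¹)
      (c.gPart (c.basisDeg h p.1 p.2))⁻¹ = c.mPart z⁻¹ := by
    simp only [ra, mPart_mul_mul, Subgroup.coe_inv]
    simp
  simp only [bideg]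
  rw [e]
  congr 2
  rw [Subgroup.coe_inv, ← mul_inv_rev, gPart_mul_mPart, inv_inv]

theorem hat_delta (h : c.LeftDivision) (y x z : X) :
    (dbl k h).hat z (delta h y x) =
      delta h (raD y (c.laD (c.basisDeg h y x) z)) ((c.laD (c.basisDeg h y x) z)⁻¹ * x * z) :=
  hat_delta' h z (y, x)

theorem ext_delta {h : c.LeftDivision} {Z : Type*} [AddCommGroup Z] [Module k Z]
    {f g : (dbl k h).carrier →ₗ[k] Z} (H : ∀ y x, f (delta h y x) = g (delta h y x)) : f = g :=
  dbl_ext fun p => H p.1 p.2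

/-- The linear map on `D` with given values on the basis. -/
def deltaLift (h : c.LeftDivision) {Z : Type*} [AddCommGroup Z] [Module k Z] (F : X → X → Z) :
    (dbl k h).carrier →ₗ[k] Z :=
  (Finsupp.linearCombination k fun p : X × X => F p.1 p.2 : (X × X →₀ k) →ₗ[k] Z)

theorem deltaLift_delta (h : c.LeftDivision) {Z : Type*} [AddCommGroup Z] [Module k Z]
    (F : X → X → Z) (y x : X) : deltaLift (k := k) h F (delta h y x) = F y x :=
  (Finsupp.linearCombination_single k 1 (y, x)).trans (one_smul k _)

/-! #### The action of `D` on objects -/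

/-- `ξ ⊗ (δ_y ⊗ x) ↦ δ_{y,‖ξ‖} ξ ◁̂ x` -/
def actLin (h : c.LeftDivision) (V : DObj c k) :
    V.carrier ⊗[k] (dbl k h).carrier →ₗ[k] V.carrier :=
  TensorProduct.lift (deltaLift h fun y x => V.hat x ∘ₗ V.dproj y).flip

theorem actLin_delta (h : c.LeftDivision) (V : DObj c k) (ξ : V.carrier) (y x : X) :
    actLin h V (ξ ⊗ₜ delta h y x) = V.hat x (V.dproj y ξ) := by
  rw [actLin, TensorProduct.lift.tmul, LinearMap.flip_apply, deltaLift_delta]; rfl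

open Classical in
theorem actLin_homog (h : c.LeftDivision) (V : DObj c k) {p : X} {ξ : V.carrier}
    (hξ : V.dproj p ξ = ξ) (y x : X) :
    actLin h V (ξ ⊗ₜ delta h y x) = if p = y then V.hat x ξ else 0 := by
  rw [actLin_delta, dproj_of_homog V hξ, apply_ite (V.hat x), map_zero]

/-- The action of `D` on an object of `𝒟`. -/
def dblAct (h : c.LeftDivision) (V : DObj c k) : V ⊗ dbl k h ⟶ V :=
  homMk (V := tensor V (dbl k h)) (W := V) (actLin h V)
    (fun i => TensorProduct.ext (ext_homog fun p ξ hξ => ext_delta fun y x => by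
      refine proj_comm (f := actLin h V) (A := tensor V (dbl k h)) (B := V)
        (dproj_tmul hξ (dproj_delta h y x)) ?_ i
      change V.dproj _ (actLin h V (ξ ⊗ₜ delta h y x)) = actLin h V (ξ ⊗ₜ delta h y x)
      rw [actLin_homog h V hξ]
      split_ifs with hp
      -- With ‖ξ‖ = y, the defining equation of ‖δ_y ⊗ x‖ turns ‖ξ‖ ∘ ‖δ_y ⊗ x‖ into ‖ξ‖ ◁̃ x, the
      -- degree of ξ ◁̂ x.
      · rw [hp, circ_basisDeg, ← hp]
        exact dproj_hat V hξ x
      · rw [map_zero]))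
    (fun z => TensorProduct.ext (ext_homog fun p ξ hξ => ext_delta fun y x => by
      change actLin h V ((tensor V (dbl k h)).hat z (ξ ⊗ₜ delta h y x)) =
        V.hat z (actLin h V (ξ ⊗ₜ delta h y x))
      -- Here ‖ξ‖ and y are conjugated by the same element a ▷̃ z, so the matching condition does
      -- not change; that element then cancels against the second label of the transformed basis
      -- vector.
      rw [hat_tmul hξ (dproj_delta h y x), hat_delta, actLin_homog h V (dproj_hat V hξ _),
        actLin_homog h V hξ, (raD_injective _).eq_iff]
      split_ifs with hp
      · rw [← hat_mul, ← hat_mul]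
        congr 2; group
      · rw [map_zero]))

theorem dblAct_natural (h : c.LeftDivision) {V W : DObj c k} (φ : V ⟶ W) :
    φ ▷ dbl k h ≫ dblAct h W = dblAct h V ≫ φ :=
  hom_ext (TensorProduct.ext (LinearMap.ext fun ξ => ext_delta fun y x => by
    change actLin h W (Hom.lin φ ξ ⊗ₜ delta h y x) = Hom.lin φ (actLin h V (ξ ⊗ₜ delta h y x))
    rw [actLin_delta, actLin_delta, Hom.map_hat]
    congr 1
    exact (Hom.map_proj φ _ ξ).symm))

/-! #### The regular object -/

/-- The projections to the homogeneous components of the regular object. -/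
def regProj (c : CosetReps X) (k : Type u) [Field k] (i : c.Bideg) :
    Module.End k (X × X →₀ k) :=
  Finsupp.linearCombination k fun p =>
    if c.bideg (raD p.1 p.2) = i then Finsupp.single p 1 else 0

/-- The action of `X` on the regular object. -/
def regHat (k : Type u) [Field k] (z : X) : Module.End k (X × X →₀ k) :=
  Finsupp.lmapDomain k k fun p => (p.1, p.2 * z)

/-- The action of `M` on the regular object. -/
def regLact (c : CosetReps X) (k : Type u) [Field k] (s : c.M) : Module.End k (X × X →₀ k) :=
  Finsupp.linearCombination k fun p =>
    regHat k (c.ra s (c.bideg (raD p.1 p.2)).2 : X)⁻¹ (Finsupp.single p 1)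

theorem regProj_single (i : c.Bideg) (p : X × X) : regProj c k i (Finsupp.single p 1) =
    if c.bideg (raD p.1 p.2) = i then Finsupp.single p 1 else 0 := by
  simp [regProj]

theorem regHat_single (z : X) (p : X × X) :
    regHat k z (Finsupp.single p 1) = Finsupp.single (p.1, p.2 * z) 1 := by
  simp [regHat]

theorem regHat_isDouble : IsDouble k (fun y => regProj c k (c.bideg y)) (regHat k) where
  R_one ξ := by
    suffices regHat k 1 = LinearMap.id from LinearMap.congr_fun this ξ
    exact dbl_ext fun p => by rw [regHat_single]; simp
  R_mul x y ξ := by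
    suffices regHat k (x * y) = regHat k y ∘ₗ regHat k x from LinearMap.congr_fun this ξ
    exact dbl_ext fun p => by
      rw [LinearMap.comp_apply, regHat_single, regHat_single, regHat_single, mul_assoc]
  R_grade x y ξ hξ := by
    suffices regProj c k (c.bideg (raD y x)) ∘ₗ regHat k x ∘ₗ regProj c k (c.bideg y) =
        regHat k x ∘ₗ regProj c k (c.bideg y) by
      have := LinearMap.congr_fun this ξ
      simpa only [LinearMap.comp_apply, hξ] using this
    refine dbl_ext fun p => ?_
    simp only [LinearMap.comp_apply, regProj_single]
    split_ifs with hp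
    · rw [regHat_single, regProj_single, if_pos]
      rw [← raD_raD, ← c.dnorm_bideg y, ← hp, dnorm_bideg]
    · simp

theorem regProj_complete : CompleteOrthogonalIdempotents (regProj c k) := by
  rw [CompleteOrthogonalIdempotents.iff_ortho_complete]
  constructor
  · intro i j hij
    refine dbl_ext fun p => ?_
    rw [Module.End.mul_apply, regProj_single]
    split_ifs with hp
    · rw [regProj_single, if_neg (by rintro rfl; exact hij hp)]; rfl
    · rw [map_zero]; rfl
  · refine dbl_ext fun p => ?_
    rw [LinearMap.sum_apply]
    simp [regProj_single]

theorem regLact_homog (a : c.M) (w : c.G) (s : c.M) (ξ : X × X →₀ k)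
    (hξ : regProj c k (a, w) ξ = ξ) : regLact c k s ξ = regHat k (c.ra s w : X)⁻¹ ξ := by
  suffices regLact c k s ∘ₗ regProj c k (a, w) =
      regHat k (c.ra s w : X)⁻¹ ∘ₗ regProj c k (a, w) by
    have := LinearMap.congr_fun this ξ
    simpa only [LinearMap.comp_apply, hξ] using this
  refine dbl_ext fun p => ?_
  simp only [LinearMap.comp_apply, regProj_single]
  split_ifs with hp
  · simp [regLact, hp]
  · simp

variable (c k) in
/-- The regular object, with basis `e_{p,x}` of degree `p ◁̃ x` on which `X` acts by
`e_{p,x} ◁̂ z = e_{p,xz}`. -/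
def reg : DObj c k where
  carrier := X × X →₀ k
  proj := regProj c k
  ract u := regHat k u
  lact := regLact c k
  isDObj := regHat_isDouble.isDObj regProj_complete (fun _ => rfl) regLact_homog

variable (c k) in
/-- The basis element `e_{p,x}` of the regular object. -/
def regBasis (p x : X) : (reg c k).carrier := (Finsupp.single (p, x) 1 : X × X →₀ k)

variable (c) in
/-- The linear map on the regular object with given values on the basis. -/
def regLift {Z : Type*} [AddCommGroup Z] [Module k Z] (F : X → X → Z) :
    (reg c k).carrier →ₗ[k] Z :=
  (Finsupp.linearCombination k fun p : X × X => F p.1 p.2 : (X × X →₀ k) →ₗ[k] Z)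

theorem regLift_regBasis {Z : Type*} [AddCommGroup Z] [Module k Z] (F : X → X → Z) (p x : X) :
    regLift c F (regBasis c k p x) = F p x :=
  (Finsupp.linearCombination_single k 1 (p, x)).trans (one_smul k _)

theorem dproj_regBasis (p x : X) :
    (reg c k).dproj (raD p x) (regBasis c k p x) = regBasis c k p x :=
  (regProj_single _ _).trans (if_pos rfl)

theorem hat_regBasis (p x z : X) :
    (reg c k).hat z (regBasis c k p x) = regBasis c k p (x * z) := by
  rw [hat_unique (reg c k) (R := regHat k) regHat_isDouble (fun _ => rfl) regLact_homog z]
  exact regHat_single z (p, x)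

/-! ### Faithfulness of the action of D. -/

/-- The degree of `δ_y ⊗ x`, recovered from `e_{p,u} ⊗ ε`, the image of `(δ_y ⊗ x) ⊗ ε` with
`‖ε‖ = s` under the action on the regular object. -/
def _root_.CosetReps.recoverDeg (h : c.LeftDivision) (p u s : X) : X :=
  (c.gPart s : X)⁻¹ * (c.existsUnique_circ h p (c.circ (raD p u) s)).choose * (c.mPart s : X)⁻¹

/-- With a = ‖δ_y ⊗ x‖, p = y ◁̃ τ̃(a,s) and u = τ̃(a,s)⁻¹x, the relation `circ_circ` gives p ∘ (a ∘
s) = (y ∘ a) ∘ s = (p ◁̃ u) ∘ s. Unique left division yields a ∘ s, and a is read off from it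
because s is known. -/
theorem _root_.CosetReps.recoverDeg_eq (h : c.LeftDivision) (y x s : X) :
    c.recoverDeg h (raD y (c.tauD (c.basisDeg h y x) s))
      ((c.tauD (c.basisDeg h y x) s : X)⁻¹ * x) s = c.basisDeg h y x := by
  set r := c.basisDeg h y x with hr
  have e : c.circ (raD y (c.tauD r s)) (c.circ r s) =
      c.circ (raD (raD y (c.tauD r s)) ((c.tauD r s : X)⁻¹ * x)) s := by
    rw [← circ_circ, raD_raD, mul_inv_cancel_left, hr, circ_basisDeg]
  rw [recoverDeg, ← (c.existsUnique_circ h _ _).choose_spec.2 _ e, circ]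
  group

/-- The regular object alone separates: acting on one fixed vector of it is a linear map on D ⊗ E
with a left inverse. -/
theorem dblAct_faithful (h : c.LeftDivision) :
    ActFaithful (C := DObj c k) (U := fun V => V) (dblAct h) := by
  classical
  have := Fintype.ofFinite X
  intro A E f g hfg
  -- An inhomogeneous vector with one free generator in each degree, so that every δ_y ⊗ x finds
  -- exactly one summand to act on.
  let ξ₀ : (reg c k).carrier := ∑ p : X, regBasis c k p 1
  let J : (dbl k h).carrier ⊗[k] E.carrier →ₗ[k] (reg c k).carrier ⊗[k] E.carrier :=
    TensorProduct.map (actLin h (reg c k)) LinearMap.id ∘ₗ assocInvLin (reg c k) (dbl k h) E ∘ₗ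
      TensorProduct.mk k _ _ ξ₀
  -- The left inverse of `J`. It undoes the shift by τ̃ that the inverse associator puts into the
  -- labels; since τ̃ depends on the degree of the E-component, the map is assembled from the
  -- homogeneous components of E.
  let K : (reg c k).carrier ⊗[k] E.carrier →ₗ[k] (dbl k h).carrier ⊗[k] E.carrier :=
    ∑ l, TensorProduct.map (regLift c fun p u =>
      delta h (raD p (c.tauD (c.recoverDeg h p u (c.dnorm l)) (c.dnorm l) : X)⁻¹)
        (c.tauD (c.recoverDeg h p u (c.dnorm l)) (c.dnorm l) * u)) (E.proj l)
  have hJ : ∀ y x s ε, E.dproj s ε = ε → J (delta h y x ⊗ₜ ε) =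
      regBasis c k (raD y (c.tauD (c.basisDeg h y x) s))
        ((c.tauD (c.basisDeg h y x) s : X)⁻¹ * x) ⊗ₜ ε := by
    intro y x s ε hε
    simp only [J, LinearMap.comp_apply, TensorProduct.mk_apply]
    rw [assocInvLin_tmul _ (dproj_delta h y x) hε, TensorProduct.map_tmul, LinearMap.id_apply]
    congr 1
    simp only [ξ₀, map_sum, TensorProduct.sum_tmul]
    rw [Finset.sum_eq_single (raD y (c.tauD (c.basisDeg h y x) s))]
    · rw [actLin_homog h _ (dproj_hat _ (dproj_regBasis _ _) _), if_pos, hat_regBasis,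
        hat_regBasis, one_mul]
      rw [raD_raD, raD_raD, one_mul, mul_inv_cancel, raD_one_right]
    · intro p _ hp
      rw [actLin_homog h _ (dproj_hat _ (dproj_regBasis _ _) _), if_neg]
      intro e
      apply hp
      have e' := congrArg (raD · (c.tauD (c.basisDeg h y x) s : X)) e
      rwa [raD_raD, raD_raD, one_mul, inv_mul_cancel, raD_one_right] at e'
    · simp
  have hKJ : K ∘ₗ J = LinearMap.id := by
    refine TensorProduct.ext (ext_delta fun y x => ext_homog fun s ε hε => ?_)
    change K (J (delta h y x ⊗ₜ ε)) = delta h y x ⊗ₜ ε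
    rw [hJ y x s ε hε]
    simp only [K, LinearMap.sum_apply, TensorProduct.map_tmul]
    rw [Finset.sum_eq_single (c.bideg s)]
    · have e : E.proj (c.bideg s) ε = ε := hε
      rw [e, dnorm_bideg]
      congr 1
      rw [regLift_regBasis, recoverDeg_eq, raD_raD, mul_inv_cancel, raD_one_right, mul_inv_cancel_left]
    · intro l _ hl
      rw [proj_of_homog E.isDObj.grading hε, if_neg hl, TensorProduct.tmul_zero]
    · simp
  refine hom_ext (LinearMap.ext fun a => ?_)
  have key : J (Hom.lin f a) = J (Hom.lin g a) :=
    LinearMap.congr_fun (congrArg Hom.lin (hfg (reg c k))) (ξ₀ ⊗ₜ a)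
  exact (LinearMap.congr_fun hKJ _).symm.trans ((congrArg K key).trans (LinearMap.congr_fun hKJ _))

end DObj

section Bialgebra

open CosetReps

variable {X : Type u} [Group X] [Fintype X] [DecidableEq X] {c : CosetReps X} {k : Type u}
  [Field k]

namespace CosetReps

theorem coe_mPart (x : X) : (c.mPart x : X) = (c.gPart x : X)⁻¹ * x := by
  rw [eq_inv_mul_iff_mul_eq, gPart_mul_mPart]

end CosetReps

namespace DObj

/-! #### Product, unit and counit -/

/-- With a, b the degrees of the factors, (y ◁̃ τ̃(a,b)) ∘ (a ∘ b) = (y ∘ a) ∘ b = (y ◁̃ x) ◁̃ z.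
Thus the τ̃-twist in the product is what makes the degree of a nonzero product equal to a ∘ b. -/
theorem basisDeg_mul (h : c.LeftDivision) (y x z : X) :
    c.basisDeg h (raD y (c.tauD (c.basisDeg h y x) (c.basisDeg h (raD y x) z)))
      ((c.tauD (c.basisDeg h y x) (c.basisDeg h (raD y x) z) : X)⁻¹ * x * z) =
    c.circ (c.basisDeg h y x) (c.basisDeg h (raD y x) z) := by
  refine (c.eq_basisDeg h ?_).symm
  rw [← circ_circ, circ_basisDeg, circ_basisDeg, raD_raD, raD_raD]
  congr 1; group

/-- The product of `D` as a linear map. -/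
def mulLin (h : c.LeftDivision) :
    (dbl k h).carrier ⊗[k] (dbl k h).carrier →ₗ[k] (dbl k h).carrier :=
  TensorProduct.lift (deltaLift h fun y x => deltaLift h fun w z => mulFormula h y x w z)

theorem mulLin_delta (h : c.LeftDivision) (y x w z : X) :
    mulLin (k := k) h (delta h y x ⊗ₜ delta h w z) = mulFormula h y x w z := by
  rw [mulLin, TensorProduct.lift.tmul, deltaLift_delta, deltaLift_delta]

/-- The product of `D`. -/
def dblMul (h : c.LeftDivision) : dbl k h ⊗ dbl k h ⟶ dbl k h :=
  homMk (V := tensor (dbl k h) (dbl k h)) (W := dbl k h) (mulLin h)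
    (fun i => TensorProduct.ext (ext_delta fun y x => ext_delta fun w z => by
      refine proj_comm (f := mulLin h) (A := tensor (dbl k h) (dbl k h)) (B := dbl k h)
        (dproj_tmul (dproj_delta h y x) (dproj_delta h w z)) ?_ i
      change (dbl k h).dproj _ (mulLin h (delta h y x ⊗ₜ delta h w z)) =
        mulLin h (delta h y x ⊗ₜ delta h w z)
      rw [mulLin_delta]
      simp only [mulFormula]
      split_ifs with hw
      · subst hw
        rw [← basisDeg_mul]
        exact dproj_delta h _ _
      · rw [map_zero]))
    (fun t => TensorProduct.ext (ext_delta fun y x => ext_delta fun w z => by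
      change mulLin h ((tensor (dbl k h) (dbl k h)).hat t (delta h y x ⊗ₜ delta h w z)) =
        (dbl k h).hat t (mulLin h (delta h y x ⊗ₜ delta h w z))
      rw [hat_tmul (dproj_delta h y x) (dproj_delta h w z), mulLin_delta]
      rw [hat_delta, hat_delta, mulLin_delta]
      have d1 := c.basisDeg_basisHat h (c.laD (c.basisDeg h w z) t) (y, x)
      have d2 := c.basisDeg_basisHat h t (w, z)
      simp only [basisHat] at d1 d2
      -- Acting by t conjugates both w and y ◁̃ x by ‖δ_w ⊗ z‖ ▷̃ t, so the product vanishes after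
      -- the action exactly when it did before.
      have hw' : raD w (c.laD (c.basisDeg h w z) t) =
          raD (raD y (c.laD (c.basisDeg h y x) (c.laD (c.basisDeg h w z) t)))
            ((c.laD (c.basisDeg h y x) (c.laD (c.basisDeg h w z) t))⁻¹ * x *
              c.laD (c.basisDeg h w z) t) ↔ w = raD y x := by
        rw [raD_raD, mul_assoc, mul_inv_cancel_left, ← raD_raD, (raD_injective _).eq_iff]
      simp only [mulFormula, d1, d2, hw']
      split_ifs with hw
      · subst hw
        rw [hat_delta, basisDeg_mul, raD_raD, raD_raD, laD_circ]
        congr 1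
        -- The cocycle relation between τ̃ and ▷̃ matches the twist before the action with the one
        -- after it.
        have e := c.laD_circ (c.basisDeg h y x) (c.basisDeg h (raD y x) z) t
        rw [eq_comm, ← eq_inv_mul_iff_mul_eq] at e
        rw [e]; group
      · rw [map_zero]))

/-- Acting twice is nonzero only if ‖ξ‖ = y and y ◁̃ x = w, and then gives ξ ◁̂ xz. On the other
side Φ first applies τ̃(a,b) to ξ; the twist in both labels of the product compensates for this. -/
theorem dblAct_mul (h : c.LeftDivision) (V : DObj c k) :
    dblAct h V ▷ dbl k h ≫ dblAct h V = (α_ V _ _).hom ≫ V ◁ dblMul h ≫ dblAct h V :=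
  hom_ext (TensorProduct.ext (TensorProduct.ext (ext_homog fun p ξ hξ => ext_delta fun y x =>
    ext_delta fun w z => by
      change actLin h V (actLin h V (ξ ⊗ₜ delta h y x) ⊗ₜ delta h w z) =
        actLin h V (TensorProduct.map LinearMap.id (mulLin h)
          (assocLin V (dbl k h) (dbl k h) ((ξ ⊗ₜ delta h y x) ⊗ₜ delta h w z)))
      rw [assocLin_tmul _ (dproj_delta h y x) (dproj_delta h w z), TensorProduct.map_tmul,
        mulLin_delta, actLin_homog h V hξ, mulFormula, LinearMap.id_apply]
      split_ifs with h1 h2 h2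
      · subst h1 h2
        rw [actLin_homog h V (dproj_hat V hξ _), if_pos rfl,
          actLin_homog h V (dproj_hat V hξ _), if_pos rfl, ← hat_mul, ← hat_mul]
        congr 2; group
      · subst h1
        rw [actLin_homog h V (dproj_hat V hξ _), if_neg (Ne.symm h2), TensorProduct.tmul_zero,
          map_zero]
      · rw [actLin_homog h V (dproj_hat V hξ _), if_neg ((raD_injective _).ne h1),
          TensorProduct.zero_tmul, map_zero]
      · rw [TensorProduct.zero_tmul, TensorProduct.tmul_zero, map_zero])))

/-- The unit of `D`. -/
def dblOne (h : c.LeftDivision) : 𝟙_ (DObj c k) ⟶ dbl k h :=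
  homMk (V := unit c k) (W := dbl k h) (LinearMap.toSpanSingleton k _ (∑ y : X, delta h y 1))
    (fun i => LinearMap.ext_ring (by
      refine proj_comm (f := LinearMap.toSpanSingleton k _ (∑ y : X, delta h y 1))
        (A := unit c k) (B := dbl k h) (dproj_unit 1) ?_ i
      rw [LinearMap.toSpanSingleton_apply, one_smul, map_sum]
      refine Finset.sum_congr rfl fun y _ => ?_
      simpa only [basisDeg_one_right] using dproj_delta (k := k) h y 1))
    (fun t => LinearMap.ext_ring (by
      change LinearMap.toSpanSingleton k _ _ ((unit c k).hat t 1) =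
        (dbl k h).hat t (LinearMap.toSpanSingleton k _ _ 1)
      rw [hat_unit, LinearMap.toSpanSingleton_apply, one_smul, map_sum]
      have e : ∀ y, (dbl k h).hat t (delta h y 1) = delta h (raD y t) 1 := fun y => by
        rw [hat_delta, basisDeg_one_right, laD_one_left, mul_one, inv_mul_cancel]
      simp only [e]
      -- The vectors δ_y ⊗ e have trivial degree, so t only permutes the summands by conjugating y.
      exact (Function.Bijective.sum_comp (Finite.injective_iff_bijective.1 (raD_injective t))
        fun y => delta h y 1).symm))

theorem lin_dblOne (h : c.LeftDivision) :
    Hom.lin (dblOne (k := k) h) (1 : k) = ∑ y : X, delta h y 1 := by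
  change LinearMap.toSpanSingleton k _ _ (1 : k) = _
  rw [LinearMap.toSpanSingleton_apply, one_smul]

theorem dblAct_one (h : c.LeftDivision) (V : DObj c k) :
    V ◁ dblOne h ≫ dblAct h V = (ρ_ V).hom :=
  hom_ext (TensorProduct.ext (ext_homog fun p ξ hξ => LinearMap.ext_ring (by
    change actLin h V (ξ ⊗ₜ Hom.lin (dblOne (k := k) h) (1 : k)) = (1 : k) • ξ
    rw [lin_dblOne, TensorProduct.tmul_sum, map_sum, one_smul, Finset.sum_eq_single p]
    · rw [actLin_homog h V hξ, if_pos rfl, hat_one]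
    · intro y _ hy
      rw [actLin_homog h V hξ, if_neg (Ne.symm hy)]
    · simp)))

/-- The counit of `D`. -/
def dblCounit (h : c.LeftDivision) : dbl k h ⟶ 𝟙_ (DObj c k) :=
  homMk (V := dbl k h) (W := unit c k) (deltaLift h fun y _ => if y = 1 then (1 : k) else 0)
    (fun i => ext_delta fun y x => by
      refine proj_comm (f := deltaLift h fun y _ => if y = 1 then (1 : k) else 0)
        (A := dbl k h) (B := unit c k) (dproj_delta h y x) ?_ i
      rw [deltaLift_delta]
      split_ifs with hy
      · rw [hy, basisDeg_one_left]
        exact dproj_unit 1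
      · rw [map_zero])
    (fun t => ext_delta fun y x => by
      rw [LinearMap.comp_apply, LinearMap.comp_apply, hat_unit, hat_delta, deltaLift_delta,
        deltaLift_delta]
      congr 1
      rw [eq_iff_iff, ← (raD_injective (c.laD (c.basisDeg h y x) t)).eq_iff (a := y), raD_one_left])

theorem lin_dblCounit (h : c.LeftDivision) (y x : X) :
    Hom.lin (dblCounit (k := k) h) (delta h y x) = (if y = 1 then 1 else 0 : k) :=
  deltaLift_delta h _ y x

theorem dblAct_unit (h : c.LeftDivision) :
    dblAct h (𝟙_ (DObj c k)) = (λ_ _).hom ≫ dblCounit h :=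
  hom_ext (TensorProduct.ext (LinearMap.ext_ring (ext_delta fun y x => by
    change actLin h (unit c k) ((1 : k) ⊗ₜ delta h y x) =
      Hom.lin (dblCounit (k := k) h) ((1 : k) • delta h y x)
    rw [one_smul, lin_dblCounit, actLin_homog h (unit c k) (dproj_unit 1), hat_unit]
    simp only [eq_comm])))

end DObj

end Bialgebra

/-! #### The coproduct -/

section Coproduct

open CosetReps

variable {X : Type u} [Group X] [Fintype X] [DecidableEq X] {c : CosetReps X} {k : Type u}
  [Field k]

namespace DObj

theorem deg₂_eq (h : c.LeftDivision) (y x z : X) : deg₂ h y x z =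
    c.gPart (c.basisDeg h y x) * z⁻¹ * (c.gPart (c.basisDeg h y x) : X)⁻¹ * x⁻¹ * z * x := by
  simp [deg₂, bideg]

theorem deg₁_eq (h : c.LeftDivision) (y x z : X) : deg₁ h y x z =
    (c.gPart (deg₂ h y x z) : X)⁻¹ * c.basisDeg h y x * (c.mPart (deg₂ h y x z) : X)⁻¹ := by
  simp [deg₁, bideg]

/-- This is the origin of the formula for ‖h₍₁₎‖: it makes each summand of Δ(h) have degree ‖h‖. -/
theorem circ_deg (h : c.LeftDivision) (y x z : X) :
    c.circ (deg₁ h y x z) (deg₂ h y x z) = c.basisDeg h y x := by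
  rw [circ, deg₁_eq]; group

/-- The first factor of the summand of `Δ(δ_y ⊗ x)` belonging to `(z, w)`. -/
def comulFst (h : c.LeftDivision) (y x : X) (p : X × X) : X × X :=
  (raD p.2 ((c.gPart (c.basisDeg h y x) : X)⁻¹ * c.gPart (deg₂ h y x p.1) *
      c.gPart (deg₁ h y x p.1)),
    (c.gPart (deg₁ h y x p.1) : X)⁻¹ * (c.gPart (deg₂ h y x p.1) : X)⁻¹ *
      c.gPart (c.basisDeg h y x) * x * (c.mPart (deg₂ h y x p.1) : X)⁻¹)

/-- The second factor of the summand of `Δ(δ_y ⊗ x)` belonging to `(z, w)`. -/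
def comulSnd (h : c.LeftDivision) (y x : X) (p : X × X) : X × X :=
  (raD p.1 ((c.gPart (c.basisDeg h y x) : X)⁻¹ * c.gPart (deg₂ h y x p.1)),
    (c.gPart (deg₂ h y x p.1) : X)⁻¹ * c.gPart (c.basisDeg h y x) * x)

theorem comulFormula_eq (h : c.LeftDivision) (y x : X) :
    comulFormula (k := k) h y x = ∑ p : X × X with p.1 * p.2 = y,
      delta h (comulFst h y x p).1 (comulFst h y x p).2 ⊗ₜ[k]
        delta h (comulSnd h y x p).1 (comulSnd h y x p).2 := by
  simp [comulFormula, comulFst, comulSnd, bideg]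

/-- The labels in Δ are written with prescribed degrees; uniqueness of left division shows that
these are the true degrees of the factors. -/
theorem basisDeg_comulSnd (h : c.LeftDivision) (y x : X) (p : X × X) :
    c.basisDeg h (comulSnd h y x p).1 (comulSnd h y x p).2 = deg₂ h y x p.1 := by
  refine (c.eq_basisDeg h ?_).symm
  rw [circ, coe_mPart, comulSnd]
  generalize (c.gPart (deg₂ h y x p.1) : X) = g
  rw [deg₂_eq]
  simp only [raD]; group

theorem basisDeg_comulFst (h : c.LeftDivision) {y : X} (x : X) {p : X × X} (hp : p.1 * p.2 = y) :
    c.basisDeg h (comulFst h y x p).1 (comulFst h y x p).2 = deg₁ h y x p.1 := by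
  refine (c.eq_basisDeg h ?_).symm
  rw [circ, coe_mPart, comulFst]
  generalize (c.gPart (deg₁ h y x p.1) : X) = g₁
  rw [deg₁_eq, c.coe_mPart (deg₂ h y x p.1)]
  generalize (c.gPart (deg₂ h y x p.1) : X) = g₂
  have e := c.circ_basisDeg h y x
  rw [circ, coe_mPart] at e
  -- The defining equation of ‖h‖, solved for ‖h‖ with its G-part kept as a parameter. With the
  -- G-parts generalized, the claim is an identity of words in a free group; zw = y enters only
  -- here.
  have e' : c.basisDeg h y x =
      (c.gPart (c.basisDeg h y x) : X) * y⁻¹ * (c.gPart (c.basisDeg h y x) : X)⁻¹ * raD y x := by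
    rw [← e]; group
  rw [deg₂_eq]
  generalize (c.gPart (c.basisDeg h y x) : X) = g at e' ⊢
  rw [e', ← hp]
  simp only [raD]; group

/-- The coproduct of `D` as a linear map. -/
def comulLin (h : c.LeftDivision) :
    (dbl k h).carrier →ₗ[k] (dbl k h).carrier ⊗[k] (dbl k h).carrier :=
  deltaLift h (comulFormula h)

theorem comulLin_delta (h : c.LeftDivision) (y x : X) :
    comulLin (k := k) h (delta h y x) = comulFormula h y x := deltaLift_delta _ _ _ _

/-- The coproduct formula is phrased mainly with G-parts, so expressing ▷̃ through them turns the
equivariance checks into formal group computations. -/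
theorem laD_eq (z x : X) : c.laD z x = (c.gPart z : X)⁻¹ * x * c.gPart (raD z x) := by
  rw [← braid_hat₁]; group

/-! ### Equivariance of the coproduct formula under X. -/

section Equivariance

variable (h : c.LeftDivision) (y x t z : X)

theorem basisDeg_hat : c.basisDeg h (raD y (c.laD (c.basisDeg h y x) t))
    ((c.laD (c.basisDeg h y x) t)⁻¹ * x * t) = raD (c.basisDeg h y x) t :=
  c.basisDeg_basisHat h t (y, x)

theorem deg₂_hat : deg₂ h (raD y (c.laD (c.basisDeg h y x) t))
    ((c.laD (c.basisDeg h y x) t)⁻¹ * x * t) (raD z (c.laD (c.basisDeg h y x) t)) =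
      raD (deg₂ h y x z) t := by
  rw [deg₂_eq, deg₂_eq, basisDeg_hat, laD_eq]
  simp only [raD]; group

/-- Both sides agree after ∘ with `raD (deg₂ h y x z) t`, since the composites are the transformed
‖h‖; right factors of ∘ cancel. -/
theorem deg₁_hat : deg₁ h (raD y (c.laD (c.basisDeg h y x) t))
    ((c.laD (c.basisDeg h y x) t)⁻¹ * x * t) (raD z (c.laD (c.basisDeg h y x) t)) =
      raD (deg₁ h y x z) (c.laD (deg₂ h y x z) t) := by
  refine c.circ_left_cancel (s := raD (deg₂ h y x z) t) ?_
  rw [← raD_circ, circ_deg, ← deg₂_hat, circ_deg, basisDeg_hat]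

theorem comulSnd_hat (p : X × X) : comulSnd h (raD y (c.laD (c.basisDeg h y x) t))
    ((c.laD (c.basisDeg h y x) t)⁻¹ * x * t)
    (raD p.1 (c.laD (c.basisDeg h y x) t), raD p.2 (c.laD (c.basisDeg h y x) t)) =
      c.basisHat h t (comulSnd h y x p) := by
  simp only [basisHat]
  rw [basisDeg_comulSnd]
  simp only [comulSnd]
  rw [basisDeg_hat, deg₂_hat, laD_eq, laD_eq]
  generalize (c.gPart (raD (deg₂ h y x p.1) t) : X) = g₂'
  generalize (c.gPart (raD (c.basisDeg h y x) t) : X) = g'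
  refine Prod.ext ?_ ?_
  · simp only [raD]; group
  · dsimp only; group

/-- Together with `comulSnd_hat`: t carries the summand (z, w) of Δ(h) to the summand of Δ(h ◁̂ t)
whose index is (z, w) conjugated by ‖h‖ ▷̃ t. -/
theorem comulFst_hat {y : X} {p : X × X} (hp : p.1 * p.2 = y) :
    comulFst h (raD y (c.laD (c.basisDeg h y x) t))
    ((c.laD (c.basisDeg h y x) t)⁻¹ * x * t)
    (raD p.1 (c.laD (c.basisDeg h y x) t), raD p.2 (c.laD (c.basisDeg h y x) t)) =
      c.basisHat h (c.laD (deg₂ h y x p.1) t) (comulFst h y x p) := by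
  simp only [basisHat]
  rw [basisDeg_comulFst h x hp]
  simp only [comulFst]
  rw [basisDeg_hat, deg₂_hat, deg₁_hat, laD_eq (deg₁ h y x p.1),
    laD_eq (c.basisDeg h y x),
    c.coe_mPart (raD (deg₂ h y x p.1) t), c.coe_mPart (deg₂ h y x p.1)]
  generalize (c.gPart (raD (deg₁ h y x p.1) (c.laD (deg₂ h y x p.1) t)) : X) = g₁'
  rw [laD_eq]
  generalize (c.gPart (raD (deg₂ h y x p.1) t) : X) = g₂'
  generalize (c.gPart (raD (c.basisDeg h y x) t) : X) = g'
  refine Prod.ext ?_ ?_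
  · simp only [raD]; group
  · simp only [raD]; group

end Equivariance

/-- The coproduct of `D`. -/
def dblComul (h : c.LeftDivision) : dbl k h ⟶ dbl k h ⊗ dbl k h :=
  homMk (V := dbl k h) (W := tensor (dbl k h) (dbl k h)) (comulLin h)
    (fun i => ext_delta fun y x => by
      refine proj_comm (f := comulLin h) (A := dbl k h) (B := tensor (dbl k h) (dbl k h))
        (dproj_delta h y x) ?_ i
      rw [comulLin_delta, comulFormula_eq, map_sum]
      refine Finset.sum_congr rfl fun p hp => ?_
      have h1 := dproj_delta (k := k) h (comulFst h y x p).1 (comulFst h y x p).2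
      have h2 := dproj_delta (k := k) h (comulSnd h y x p).1 (comulSnd h y x p).2
      rw [basisDeg_comulFst h x (Finset.mem_filter.1 hp).2] at h1
      rw [basisDeg_comulSnd] at h2
      have := dproj_tmul h1 h2
      rwa [circ_deg] at this)
    (fun t => ext_delta fun y x => by
      change comulLin h ((dbl k h).hat t (delta h y x)) =
        (tensor (dbl k h) (dbl k h)).hat t (comulLin h (delta h y x))
      rw [hat_delta, comulLin_delta, comulLin_delta, comulFormula_eq, comulFormula_eq, map_sum]
      symm
      have hr : ∀ a g : X, raD (raD a g) g⁻¹ = a := fun a g => by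
        rw [raD_raD, mul_inv_cancel, raD_one_right]
      have hl : ∀ a g : X, raD (raD a g⁻¹) g = a := fun a g => by
        rw [raD_raD, inv_mul_cancel, raD_one_right]
      -- Simultaneous conjugation of z and w by ‖h‖ ▷̃ t maps the factorisations of y onto those of
      -- its conjugate.
      refine Finset.sum_nbij'
        (fun p => (raD p.1 (c.laD (c.basisDeg h y x) t), raD p.2 (c.laD (c.basisDeg h y x) t)))
        (fun p => (raD p.1 (c.laD (c.basisDeg h y x) t)⁻¹, raD p.2 (c.laD (c.basisDeg h y x) t)⁻¹))
        ?_ ?_ ?_ ?_ ?_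
      · intro p hp
        rw [Finset.mem_filter] at hp ⊢
        refine ⟨Finset.mem_univ _, ?_⟩
        rw [← hp.2]; simp only [raD]; group
      · intro p hp
        rw [Finset.mem_filter] at hp ⊢
        refine ⟨Finset.mem_univ _, ?_⟩
        refine Eq.trans ?_ ((congrArg (raD · _) hp.2).trans (hr y _))
        simp only [raD]; group
      · intro p _; simp only [hr]
      · intro p _; simp only [hl]
      · intro p hp
        have hp := (Finset.mem_filter.1 hp).2
        have h1 := dproj_delta (k := k) h (comulFst h y x p).1 (comulFst h y x p).2
        have h2 := dproj_delta (k := k) h (comulSnd h y x p).1 (comulSnd h y x p).2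
        rw [basisDeg_comulSnd] at h2
        refine (hat_tmul h1 h2 t).trans ?_
        rw [hat_delta', hat_delta', comulSnd_hat, comulFst_hat h x t hp])

/-- `C` collects the inverse associator and the braiding acting on η, `L` the braiding and the
associator acting on a, and ξ receives the two outer associators. `C` and `L` are variables with
defining equations so that simpler expressions can be supplied for them. -/
theorem tensorμ_tmul {V W A B : DObj c k} {q r s : X} (ξ : V.carrier)
    {η : W.carrier} {a : A.carrier} {b : B.carrier} (hη : W.dproj q η = η)
    (ha : A.dproj r a = a) (hb : B.dproj s b = b) (C : X)
    (hC : C = (c.tauD r s : X)⁻¹ * (c.gPart r : X)⁻¹) (L : X)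
    (hL : L = (c.mPart (raD q C) : X)⁻¹ * c.tauD (raD q C) s) :
    Hom.lin (tensorμ V W A B) ((ξ ⊗ₜ η) ⊗ₜ (a ⊗ₜ b)) =
      (V.hat (c.tauD q (c.circ r s) * (c.tauD (raD r L) (c.circ (raD q C) s) : X)⁻¹) ξ ⊗ₜ
        A.hat L a) ⊗ₜ (W.hat C η ⊗ₜ b) := by
  change assocInvLin V A (tensor W B) (TensorProduct.map LinearMap.id (assocLin A W B)
    (TensorProduct.map LinearMap.id (TensorProduct.map (braidLin W A) LinearMap.id)
      (TensorProduct.map LinearMap.id (assocInvLin W A B)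
        (assocLin V W (tensor A B) ((ξ ⊗ₜ η) ⊗ₜ (a ⊗ₜ b)))))) = _
  have hη' := dproj_hat W hη C
  have ha' := dproj_hat A ha L
  rw [assocLin_tmul (W := tensor A B) _ hη (dproj_tmul ha hb), TensorProduct.map_tmul,
    assocInvLin_tmul _ ha hb, TensorProduct.map_tmul, TensorProduct.map_tmul,
    TensorProduct.map_tmul, braidLin_tmul (dproj_hat W hη _) ha, raD_raD, ← hC, ← hat_mul, ← hC]
  simp only [LinearMap.id_apply]
  rw [assocLin_tmul _ hη' hb, ← hat_mul, ← hL,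
    assocInvLin_tmul (W := tensor W B) _ ha' (dproj_tmul hη' hb), ← hat_mul]

/-! ### Twists produced by interchanging W with the first factor of Δ(h). -/

section Twist

variable (h : c.LeftDivision) (y x z : X)

/-- The twist that η undergoes when passing h₍₁₎ is |h||h₍₂₎|⁻¹, the very element conjugating z in
the second factor of Δ(h). Hence that factor acts nontrivially only for ‖η‖ = z. -/
theorem inv_tauD_deg : (c.gPart (c.basisDeg h y x) : X)⁻¹ * c.gPart (deg₂ h y x z) =
    (c.tauD (deg₁ h y x z) (deg₂ h y x z) : X)⁻¹ * (c.gPart (deg₁ h y x z) : X)⁻¹ := by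
  have e := hexagon₂ (c := c) (deg₁ h y x z) (deg₂ h y x z)
  rw [circ_deg, ← eq_inv_mul_iff_mul_eq] at e
  rw [e]; group

theorem circ_raD_deg₂ : c.circ (raD z ((c.gPart (c.basisDeg h y x) : X)⁻¹ *
    c.gPart (deg₂ h y x z))) (deg₂ h y x z) = raD z x := by
  rw [circ, coe_mPart]
  generalize (c.gPart (deg₂ h y x z) : X) = g₂
  rw [deg₂_eq]
  simp only [raD]; group

/-- Conservation of degree under the interchange, for ‖η‖ = z. It makes the M-parts in the two outer
associators coincide, so that they cancel in `tauD_mul_inv_tauD`. -/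
theorem circ_raD_deg₁ : c.circ (raD (deg₁ h y x z)
      ((c.mPart (deg₂ h y x z) : X) * (c.mPart (raD z x) : X)⁻¹)) (raD z x) =
    c.circ z (c.basisDeg h y x) := by
  rw [circ, circ, c.coe_gPart (raD z x), c.coe_mPart (c.basisDeg h y x), deg₁_eq,
    c.coe_mPart (deg₂ h y x z)]
  generalize (c.mPart (raD z x) : X) = m
  generalize (c.gPart (deg₂ h y x z) : X) = g₂
  rw [deg₂_eq]
  simp only [raD]; group

theorem tauD_mul_inv_tauD : (c.tauD z (c.basisDeg h y x) : X) *
    (c.tauD (raD (deg₁ h y x z) ((c.mPart (deg₂ h y x z) : X) * (c.mPart (raD z x) : X)⁻¹))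
      (raD z x) : X)⁻¹ =
    c.mPart z * ((c.gPart (c.basisDeg h y x) : X)⁻¹ * c.gPart (deg₂ h y x z) *
      c.gPart (deg₁ h y x z)) * c.laD (deg₁ h y x z)
        ((c.mPart (deg₂ h y x z) : X) * (c.mPart (raD z x) : X)⁻¹) := by
  have hm := congrArg c.mPart (circ_raD_deg₁ h y x z)
  rw [(c.parts_circ _ _).2, (c.parts_circ _ _).2] at hm
  rw [coe_tauD, coe_tauD, hm, laD_eq, c.coe_mPart (raD (deg₁ h y x z) _)]
  generalize (c.gPart (raD (deg₁ h y x z) _) : X) = g₁'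
  generalize (c.gPart (deg₁ h y x z) : X) = g₁
  rw [deg₁_eq, c.coe_mPart (c.basisDeg h y x)]
  simp only [raD]; group

end Twist

-- Because zw = y, the condition p ∘ z = y is equivalent to p ◁̃ ⟨z⟩ = w, the matching condition for
-- the first factor. When both conditions hold, all twists cancel against the labels and leave the
-- action of x on ξ ⊗ η.
open Classical in
theorem dblAct_comul_term (h : c.LeftDivision) {V W : DObj c k} {p q : X} {ξ : V.carrier}
    {η : W.carrier} (hξ : V.dproj p ξ = ξ) (hη : W.dproj q η = η) {y : X} (x : X) {i : X × X}
    (hi : i.1 * i.2 = y) :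
    TensorProduct.map (actLin h V) (actLin h W) (Hom.lin (tensorμ V W (dbl k h) (dbl k h))
      ((ξ ⊗ₜ η) ⊗ₜ (delta h (comulFst h y x i).1 (comulFst h y x i).2 ⊗ₜ
        delta h (comulSnd h y x i).1 (comulSnd h y x i).2))) =
    if i.1 = q ∧ c.circ p q = y then V.hat (c.laD q x) ξ ⊗ₜ W.hat x η else 0 := by
  have h1 := dproj_delta (k := k) h (comulFst h y x i).1 (comulFst h y x i).2
  have h2 := dproj_delta (k := k) h (comulSnd h y x i).1 (comulSnd h y x i).2
  rw [basisDeg_comulFst h x hi] at h1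
  rw [basisDeg_comulSnd] at h2
  rw [tensorμ_tmul ξ hη h1 h2 _ (inv_tauD_deg h y x i.1) _ rfl, TensorProduct.map_tmul,
    actLin_homog h W (dproj_hat W hη _)]
  have e2 : raD q ((c.gPart (c.basisDeg h y x) : X)⁻¹ * c.gPart (deg₂ h y x i.1)) =
      (comulSnd h y x i).1 ↔ i.1 = q := by
    rw [comulSnd, (raD_injective _).eq_iff, eq_comm]
  rw [e2]
  by_cases hq : i.1 = q
  swap
  · rw [if_neg hq, if_neg (fun h' => hq h'.1), TensorProduct.tmul_zero]
  obtain ⟨z, w⟩ := i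
  dsimp only at hq hi
  subst hq
  -- In the remaining case ‖η‖ = z the twist `L` collapses to ⟨h₍₂₎⟩⟨z ◁̃ x⟩⁻¹; its first factor
  -- cancels the ⟨h₍₂₎⟩⁻¹ in the formula for Δ.
  have eL : (c.mPart (raD z ((c.gPart (c.basisDeg h y x) : X)⁻¹ * c.gPart (deg₂ h y x z))) : X)⁻¹ *
      c.tauD (raD z ((c.gPart (c.basisDeg h y x) : X)⁻¹ * c.gPart (deg₂ h y x z)))
        (deg₂ h y x z) = (c.mPart (deg₂ h y x z) : X) * (c.mPart (raD z x) : X)⁻¹ := by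
    rw [coe_tauD, ← (c.parts_circ _ _).2, circ_raD_deg₂]; group
  have eA := tauD_mul_inv_tauD h y x z
  rw [if_pos rfl, eL, circ_deg, circ_raD_deg₂, eA, hat_delta, basisDeg_comulFst h x hi,
    actLin_homog h V (dproj_hat V hξ _), ← hat_mul, ← hat_mul]
  have e1 : raD p (c.mPart z * ((c.gPart (c.basisDeg h y x) : X)⁻¹ * c.gPart (deg₂ h y x z) *
      c.gPart (deg₁ h y x z)) * c.laD (deg₁ h y x z)
        ((c.mPart (deg₂ h y x z) : X) * (c.mPart (raD z x) : X)⁻¹)) =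
      raD (comulFst h y x (z, w)).1 (c.laD (deg₁ h y x z)
        ((c.mPart (deg₂ h y x z) : X) * (c.mPart (raD z x) : X)⁻¹)) ↔ c.circ p z = y := by
    rw [comulFst, ← raD_raD, ← raD_raD, (raD_injective _).eq_iff, (raD_injective _).eq_iff,
      ← hi, circ, raD, coe_gPart, ← mul_right_inj z]
    simp only [mul_assoc]
  simp only [true_and, e1]
  split_ifs with hp
  · congr 3
    · rw [comulFst, show c.laD z x = c.mPart z * x * (c.mPart (raD z x) : X)⁻¹ from rfl]
      group
    · rw [comulSnd]; group
  · rw [TensorProduct.zero_tmul]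

theorem dblAct_comul (h : c.LeftDivision) (V W : DObj c k) :
    dblAct h (V ⊗ W) =
      (V ⊗ W) ◁ dblComul h ≫ tensorμ V W _ _ ≫ (dblAct h V ⊗ₘ dblAct h W) :=
  hom_ext (TensorProduct.ext (ext_homog₂ (V := V) (W := W) fun p ξ q η hξ hη =>
    ext_delta fun y x => by
      change actLin h (tensor V W) ((ξ ⊗ₜ η) ⊗ₜ delta h y x) =
        TensorProduct.map (actLin h V) (actLin h W) (Hom.lin (tensorμ V W (dbl k h) (dbl k h))
          ((ξ ⊗ₜ η) ⊗ₜ comulLin h (delta h y x)))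
      rw [comulLin_delta, comulFormula_eq, TensorProduct.tmul_sum, map_sum, map_sum,
        Finset.sum_congr rfl fun i hi =>
          dblAct_comul_term h hξ hη x (Finset.mem_filter.1 hi).2,
        actLin_homog h (tensor V W) (dproj_tmul hξ hη), hat_tmul hξ hη,
        -- Only z = ‖η‖ can contribute, and zw = y then fixes w.
        Finset.sum_eq_single (q, q⁻¹ * y)]
      · simp only [true_and]
        split_ifs <;> rfl
      · intro i hi hne
        rw [if_neg]
        rintro ⟨rfl, -⟩
        refine hne (Prod.ext rfl ?_)
        rw [← (Finset.mem_filter.1 hi).2, inv_mul_cancel_left]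
      · intro hn
        exact absurd hn (by simp)))

/-- The counit kills every summand except w = e, z = y. There ‖h₍₂₎‖ = ‖h‖, so the conjugating
element is trivial and the second factor is h itself. -/
theorem dblCounit_comul (h : c.LeftDivision) :
    dblComul h ≫ dblCounit (k := k) h ▷ dbl k h = (λ_ _).inv :=
  hom_ext (ext_delta fun y x => by
    change TensorProduct.map (Hom.lin (dblCounit (k := k) h)) LinearMap.id
      (comulLin h (delta h y x)) = (1 : k) ⊗ₜ delta h y x
    rw [comulLin_delta, comulFormula_eq, map_sum, Finset.sum_eq_single (y, 1)]
    · have e : deg₂ h y x y = c.basisDeg h y x := by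
        have e := c.circ_basisDeg h y x
        rw [circ, coe_mPart] at e
        rw [deg₂_eq, mul_assoc, mul_assoc, ← mul_assoc x⁻¹]
        change _ * raD y x = _
        rw [← e]; group
      rw [TensorProduct.map_tmul, lin_dblCounit, comulFst, raD_one_left, if_pos rfl, comulSnd, e,
        inv_mul_cancel, raD_one_right, one_mul]; rfl
    · intro i hi hne
      rw [TensorProduct.map_tmul, lin_dblCounit, if_neg, TensorProduct.zero_tmul]
      intro e
      rw [comulFst, ← raD_one_left, (raD_injective _).eq_iff] at e
      refine hne (Prod.ext ?_ e)
      rw [← (Finset.mem_filter.1 hi).2, e, mul_one]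
    · simp)

/-- Only z = e, w = y survives; then ‖h₍₂₎‖ = e and ‖h₍₁₎‖ = ‖h‖, so all twists in the first factor
disappear. -/
theorem dblComul_counit (h : c.LeftDivision) :
    dblComul h ≫ dbl k h ◁ dblCounit (k := k) h = (ρ_ _).inv :=
  hom_ext (ext_delta fun y x => by
    change TensorProduct.map LinearMap.id (Hom.lin (dblCounit (k := k) h))
      (comulLin h (delta h y x)) = delta h y x ⊗ₜ (1 : k)
    rw [comulLin_delta, comulFormula_eq, map_sum, Finset.sum_eq_single (1, y)]
    · have e : deg₂ h y x 1 = 1 := by rw [deg₂_eq]; group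
      have e' : deg₁ h y x 1 = c.basisDeg h y x := by
        rw [← circ_deg h y x 1, e, circ_one]
      rw [TensorProduct.map_tmul, lin_dblCounit, comulSnd, raD_one_left, if_pos rfl, comulFst, e,
        e', gPart_one, mPart_one]
      simp [raD_one_right]
    · intro i hi hne
      rw [TensorProduct.map_tmul, lin_dblCounit, if_neg, TensorProduct.tmul_zero]
      intro e
      rw [comulSnd, ← raD_one_left, (raD_injective _).eq_iff] at e
      refine hne (Prod.ext e ?_)
      rw [← (Finset.mem_filter.1 hi).2, e, one_mul]
    · simp)

end DObj

end Coproduct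

/-! ### The bialgebra `D` -/

section Main

open CosetReps

variable {X : Type u} [Group X] [Fintype X] [DecidableEq X] {c : CosetReps X} {k : Type u}
  [Field k]

namespace DObj

/-- By faithfulness, compare actions on V: both sides act as the unit, which does nothing, followed
by the given element. -/
theorem dblOne_mul (h : c.LeftDivision) :
    dblOne h ▷ dbl k h ≫ dblMul h = (λ_ (dbl k h)).hom := by
  refine (dblAct_faithful h).hom_ext fun V => ?_
  have hm : V ◁ dblMul h ≫ dblAct h V = (α_ V _ _).inv ≫ dblAct h V ▷ dbl k h ≫ dblAct h V := by
    rw [dblAct_mul, Iso.inv_hom_id_assoc]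
  rw [whiskerLeft_comp, Category.assoc, hm, associator_inv_naturality_middle_assoc,
    ← comp_whiskerRight_assoc, dblAct_one, triangle_assoc_comp_right_assoc]

theorem dblMul_one (h : c.LeftDivision) :
    dbl k h ◁ dblOne h ≫ dblMul h = (ρ_ (dbl k h)).hom := by
  refine (dblAct_faithful h).hom_ext fun V => ?_
  have hm : V ◁ dblMul h ≫ dblAct h V = (α_ V _ _).inv ≫ dblAct h V ▷ dbl k h ≫ dblAct h V := by
    rw [dblAct_mul, Iso.inv_hom_id_assoc]
  rw [whiskerLeft_comp, Category.assoc, hm, associator_inv_naturality_right_assoc,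
    whisker_exchange_assoc, dblAct_one, rightUnitor_naturality]
  monoidal

/-- The first label of a product is a conjugate of y, so it is e exactly when y = e; in that case
the matching condition w = y ◁̃ x reads w = e. -/
theorem dblMul_counit (h : c.LeftDivision) : dblMul (k := k) h ≫ dblCounit h =
    (dblCounit h ⊗ₘ dblCounit h) ≫ (λ_ (𝟙_ (DObj c k))).hom :=
  hom_ext (TensorProduct.ext (ext_delta fun y x => ext_delta fun w z => by
    change Hom.lin (dblCounit (k := k) h) (mulLin h (delta h y x ⊗ₜ delta h w z)) =
      Hom.lin (dblCounit (k := k) h) (delta h y x) • Hom.lin (dblCounit (k := k) h) (delta h w z)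
    rw [mulLin_delta, lin_dblCounit, lin_dblCounit, mulFormula]
    by_cases hy : y = 1
    · subst hy
      rw [raD_one_left, raD_one_left, if_pos rfl, one_smul]
      split_ifs with hw
      · rw [lin_dblCounit, if_pos rfl]
      · rw [map_zero]
    · rw [if_neg hy, zero_smul]
      split_ifs with hw
      · rw [lin_dblCounit, if_neg]
        intro e
        rw [← raD_one_left, (raD_injective _).eq_iff] at e
        exact hy e
      · rw [map_zero]))

theorem dblOne_counit (h : c.LeftDivision) :
    dblOne (k := k) h ≫ dblCounit h = 𝟙 (𝟙_ (DObj c k)) :=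
  hom_ext (LinearMap.ext_ring (by
    change Hom.lin (dblCounit (k := k) h) (Hom.lin (dblOne (k := k) h) (1 : k)) = (1 : k)
    rw [lin_dblOne, map_sum]
    simp only [lin_dblCounit]
    exact (Finset.sum_ite_eq' _ _ _).trans (if_pos (Finset.mem_univ _))))

variable (k) in
/-- The bialgebra structure of `D`. -/
abbrev dblBimon (h : c.LeftDivision) : BimonObj (dbl k h) where
  one := dblOne h
  mul := dblMul h
  one_mul := dblOne_mul h
  mul_one := dblMul_one h
  mul_assoc := (dblAct_faithful h).mul_assoc (dblAct_mul h)
  counit := dblCounit h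
  comul := dblComul h
  counit_comul := dblCounit_comul h
  comul_counit := dblComul_counit h
  comul_assoc := (dblAct_faithful h).comul_assoc (dblAct_natural h) (dblAct_comul h)
  mul_comul := (dblAct_faithful h).mul_comul (dblAct_mul h) (dblAct_comul h)
  one_comul := (dblAct_faithful h).one_comul (dblAct_one h) (dblAct_comul h)
  mul_counit := dblMul_counit h
  one_counit := dblOne_counit h

end DObj

end Main

end

theorem mainTheorem9 {X : Type u} [Group X] [Fintype X] [DecidableEq X] {k : Type u} [Field k]
    (c : CosetReps X) (h : c.LeftDivision) :
    ∃ (B : BimonObj (DObj.dbl k h)) (act : ∀ V : DObj c k, V ⊗ DObj.dbl k h ⟶ V),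
      -- gradings and actions of `D`
      (∀ y x, c.circ y (c.basisDeg h y x) = CosetReps.raD y x ∧
        (DObj.dbl k h).dproj (c.basisDeg h y x) (DObj.delta h y x) = DObj.delta h y x) ∧
      (∀ y x z, (DObj.dbl k h).hat z (DObj.delta h y x) =
        DObj.delta h (CosetReps.raD y (c.laD (c.basisDeg h y x) z))
          ((c.laD (c.basisDeg h y x) z)⁻¹ * x * z)) ∧
      -- the action of `D` on objects
      (∀ V (ξ : V.carrier) y x, DObj.Hom.lin (act V) (ξ ⊗ₜ[k] DObj.delta h y x) =
        V.hat x (V.dproj y ξ)) ∧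
      -- product, unit, coproduct, counit
      (∀ y x w z, DObj.Hom.lin B.mul (DObj.delta h y x ⊗ₜ[k] DObj.delta h w z) =
        mulFormula h y x w z) ∧
      DObj.Hom.lin B.one (1 : k) = ∑ y : X, DObj.delta h y 1 ∧
      (∀ y x, DObj.Hom.lin B.comul (DObj.delta h y x) = comulFormula h y x) ∧
      (∀ y x, DObj.Hom.lin B.counit (DObj.delta h y x) = (if y = 1 then 1 else 0 : k)) ∧
      -- compatibility of the action with product, unit, counit and coproduct
      (∀ V, act V ▷ DObj.dbl k h ≫ act V = (α_ V _ _).hom ≫ V ◁ B.mul ≫ act V) ∧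
      (∀ V, V ◁ B.one ≫ act V = (ρ_ V).hom) ∧
      act (𝟙_ (DObj c k)) = (λ_ _).hom ≫ B.counit ∧
      (∀ V W, act (V ⊗ W) = (V ⊗ W) ◁ B.comul ≫ tensorμ V W _ _ ≫ (act V ⊗ₘ act W)) ∧
      -- the product and the coproduct are determined by this compatibility
      (∀ μ' : DObj.dbl k h ⊗ DObj.dbl k h ⟶ DObj.dbl k h,
        (∀ V, act V ▷ DObj.dbl k h ≫ act V = (α_ V _ _).hom ≫ V ◁ μ' ≫ act V) →
          μ' = B.mul) ∧
      (∀ Δ' : DObj.dbl k h ⟶ DObj.dbl k h ⊗ DObj.dbl k h,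
        (∀ V W, act (V ⊗ W) = (V ⊗ W) ◁ Δ' ≫ tensorμ V W _ _ ≫ (act V ⊗ₘ act W)) →
          Δ' = B.comul) := by
  refine ⟨DObj.dblBimon k h, DObj.dblAct h,
    fun y x => ⟨c.circ_basisDeg h y x, DObj.dproj_delta h y x⟩, DObj.hat_delta h,
    DObj.actLin_delta h, DObj.mulLin_delta h, DObj.lin_dblOne h, DObj.comulLin_delta h,
    DObj.lin_dblCounit h, DObj.dblAct_mul h, DObj.dblAct_one h, DObj.dblAct_unit h,
    DObj.dblAct_comul h, fun μ' hμ => ?_, fun Δ' hΔ => ?_⟩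
  -- Both products induce on V the composite of two actions.
  · refine (DObj.dblAct_faithful h).hom_ext fun V => ?_
    rw [← cancel_epi (α_ V (DObj.dbl k h) (DObj.dbl k h)).hom, ← hμ V]
    exact DObj.dblAct_mul h V
  -- Here the separating family consists of the pairs (V, W), on which both coproducts induce the
  -- action on V ⊗ W.
  · refine ((DObj.dblAct_faithful h).tensor (DObj.dblAct_faithful h)).hom_ext fun i => ?_
    exact (hΔ i.1 i.2).symm.trans (DObj.dblAct_comul h i.1 i.2)
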